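/- Let $d\ge 3$, let $T=(t_{i_1\cdots i_d})$ be a real tensor of format $n_1\times\cdots\times n_d$. The real rank of $T$ is the smallest $r$ such that $T$ is a sum of $r$ tensors of the form $v_1\otimes\cdots\otimes v_d$ with $v_m\in\mathbb{R}^{n_m}$, and the real border rank of $T$ is the smallest $r$ such that $T$ lies in the Euclidean closure of the set of $n_1\times\cdots\times n_d$ tensors of real rank $\le r$. For each set $I$ with $\emptyset\ne I\subsetneq\{1,\dots,d\}$, the flattening of $T$ along $I$ is the $\bigl(\prod_{m\in I}n_m\bigr)\times\bigl(\prod_{m\notin I}n_m\bigr)$ matrix formed by the entries of $T$, whose rows are indexed by $(i_m)_{m\in I}$ and whose columns are indexed by $(i_m)_{m\notin I}$. A $2\times2\times2$ sub-tensor of $T$ is obtained by choosing three of the $d$ indices, letting each of these take one of two chosen distinct values, and fixing the other $d-3$ indices; a sub-hyperdeterminant of $T$ is the value at such a sub-tensor $(x_{abc})_{a,b,c\in\{0,1\}}$ of the hyperdeterminant $$\begin{aligned} &x_{000}^2x_{111}^2+x_{001}^2x_{110}^2+x_{010}^2x_{101}^2+x_{011}^2x_{100}^2+4x_{000}x_{011}x_{101}x_{110}+4x_{001}x_{010}x_{100}x_{111}\\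 &-2x_{000}x_{001}x_{110}x_{111}-2x_{000}x_{010}x_{101}x_{111}-2x_{000}x_{011}x_{100}x_{111}\\ &-2x_{001}x_{010}x_{101}x_{110}-2x_{001}x_{011}x_{100}x_{110}-2x_{010}x_{011}x_{100}x_{101}. \end{aligned}$$ Then $T$ has real border rank $\le 2$ if and only if all flattenings of $T$ have rank $\le 2$ and all sub-hyperdeterminants of $T$ are $\ge 0$. If this holds, and if moreover at least one flattening of $T$ has rank exactly two and at least one sub-hyperdeterminant of $T$ is strictly positive, then the real rank of $T$ is exactly two. -/

import Mathlib

/-- The space of real tensors of format `n 0 × n 1 × ⋯ × n (d - 1)`, in coordinates,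
with the Euclidean (product) topology. -/
abbrev RealTensor {d : ℕ} (n : Fin d → ℕ) : Type :=
  (∀ m : Fin d, Fin (n m)) → ℝ

namespace RealTensor

variable {d : ℕ} {n : Fin d → ℕ}

/-- The decomposable tensor `v 0 ⊗ v 1 ⊗ ⋯ ⊗ v (d - 1)`. -/
def decomposable (v : ∀ m : Fin d, Fin (n m) → ℝ) : RealTensor n :=
  fun idx => ∏ m, v m (idx m)

/-- The real points of the affine cone over the Segre variety: all decomposable real tensors
(the zero tensor included). -/
def segreCone (n : Fin d → ℕ) : Set (RealTensor n) :=
  Set.range decomposable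

/-- `T` is a sum of `r` elements of the real Segre cone. -/
def IsSumOfDecomposables (T : RealTensor n) (r : ℕ) : Prop :=
  ∃ x : Fin r → RealTensor n, (∀ s, x s ∈ segreCone n) ∧ T = ∑ s, x s

/-- The real rank: the smallest `r` such that `T` is a sum of `r` decomposable real tensors. -/
noncomputable def realRank (T : RealTensor n) : ℕ :=
  sInf {r | IsSumOfDecomposables T r}

/-- The real border rank: the smallest `r` such that `T` is in the Euclidean closure of the set of
tensors of real rank at most `r`. -/
noncomputable def realBorderRank (T : RealTensor n) : ℕ :=
  sInf {r | T ∈ closure {S : RealTensor n | realRank S ≤ r}}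

/-- In positive order every tensor is a finite sum of decomposable tensors, so that the infimum
in `realRank` is over a nonempty set. -/
theorem exists_isSumOfDecomposables (hd : 0 < d) (T : RealTensor n) :
    ∃ r, IsSumOfDecomposables T r := by
  classical
  let e := Fintype.equivFin (∀ m : Fin d, Fin (n m))
  let z : Fin d := ⟨0, hd⟩
  refine ⟨_, fun s => decomposable fun m a =>
    (if m = z then T (e.symm s) else 1) * (if a = e.symm s m then 1 else 0),
    fun s => ⟨_, rfl⟩, ?_⟩
  funext idx
  rw [Finset.sum_apply, ← e.sum_comp]
  rw [Finset.sum_eq_single idx]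
  · simp [decomposable]
  · intro j _ hj
    obtain ⟨m, hm⟩ := Function.ne_iff.mp hj
    refine Finset.prod_eq_zero (Finset.mem_univ m) ?_
    simp [Ne.symm hm]
  · simp

/-- The infimum in `realBorderRank` is over a nonempty set. -/
theorem exists_mem_closure_realRank_le (T : RealTensor n) :
    ∃ r, T ∈ closure {S : RealTensor n | realRank S ≤ r} :=
  ⟨realRank T, subset_closure (le_refl (realRank T))⟩

/-- The flattening of `T` along `I`: the matrix whose rows are indexed by the multi-indices in the
modes belonging to `I` and whose columns are indexed by those in the remaining modes. -/
def flattening (T : RealTensor n) (I : Finset (Fin d)) :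
    Matrix (∀ m : {m // m ∈ I}, Fin (n m)) (∀ m : {m // m ∉ I}, Fin (n m)) ℝ :=
  fun a b => T fun m => if h : m ∈ I then a ⟨m, h⟩ else b ⟨m, h⟩

/-- The set of ranks of all flattenings of `T`, one for each split of the modes into two
nonempty parts. -/
noncomputable def flatteningRanks (T : RealTensor n) : Set ℕ :=
  {r | ∃ I : Finset (Fin d), I.Nonempty ∧ Iᶜ.Nonempty ∧ r = (flattening T I).rank}

/-- Cayley's hyperdeterminant of a `2 × 2 × 2` tensor. -/
def hyperdet (x : Fin 2 → Fin 2 → Fin 2 → ℝ) : ℝ :=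
  x 0 0 0 ^ 2 * x 1 1 1 ^ 2 + x 0 0 1 ^ 2 * x 1 1 0 ^ 2
    + x 0 1 0 ^ 2 * x 1 0 1 ^ 2 + x 0 1 1 ^ 2 * x 1 0 0 ^ 2
    + 4 * x 0 0 0 * x 0 1 1 * x 1 0 1 * x 1 1 0
    + 4 * x 0 0 1 * x 0 1 0 * x 1 0 0 * x 1 1 1
    - 2 * x 0 0 0 * x 0 0 1 * x 1 1 0 * x 1 1 1
    - 2 * x 0 0 0 * x 0 1 0 * x 1 0 1 * x 1 1 1
    - 2 * x 0 0 0 * x 0 1 1 * x 1 0 0 * x 1 1 1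
    - 2 * x 0 0 1 * x 0 1 0 * x 1 0 1 * x 1 1 0
    - 2 * x 0 0 1 * x 0 1 1 * x 1 0 0 * x 1 1 0
    - 2 * x 0 1 0 * x 0 1 1 * x 1 0 0 * x 1 0 1

/-- The `2 × 2 × 2` array obtained from `T` by letting the indices in the modes `i, j, k` take the
values `p, q, r` and fixing the indices in the other modes to those of `base`
(the entries of `base` in the modes `i, j, k` are overwritten). -/
def subtensor (T : RealTensor n) (base : ∀ m : Fin d, Fin (n m)) (i j k : Fin d)
    (p : Fin 2 → Fin (n i)) (q : Fin 2 → Fin (n j)) (r : Fin 2 → Fin (n k)) :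
    Fin 2 → Fin 2 → Fin 2 → ℝ :=
  fun a b c =>
    T (Function.update (Function.update (Function.update base i (p a)) j (q b)) k (r c))

/-- The set of all `2 × 2 × 2` sub-hyperdeterminants of `T`. -/
def subHyperdets (T : RealTensor n) : Set ℝ :=
  {δ | ∃ (base : ∀ m : Fin d, Fin (n m)) (i j k : Fin d)
      (p : Fin 2 → Fin (n i)) (q : Fin 2 → Fin (n j)) (r : Fin 2 → Fin (n k)),
      i < j ∧ j < k ∧ p 0 < p 1 ∧ q 0 < q 1 ∧ r 0 < r 1 ∧
        δ = hyperdet (subtensor T base i j k p q r)}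

end RealTensor

/-!
The tensor `T` is treated as a multilinear form in vectors of the modes, and the rank condition on
its flattenings as the vanishing of all `3 × 3` minors of the form.

Two modes are called linked if some slice of the form in these two modes is a matrix of rank at
least two. A mode that is linked to no other splits off as a factor
(`apply_mul_apply_of_not_linked`). Linking is transitive, and the rank condition forces two disjoint
linked pairs to be linked to each other (`Linked.trans`, `Linked.of_disjoint`). So there are two
cases. Either at most two modes are linked to other modes, and `T` is a matrix of rank at most two
times vectors in the other modes, hence a sum of two decomposable tensors. Or there are three
mutually linked modes. Then, around a generic base point, the rank condition expresses every value
of the form through values with few modes changed, and these expressions amount to multiplication in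
a quadratic algebra `ℝ[ω]`, `ω ^ 2 = a + b ω`: there are elements `A m p` of this algebra such that
`T idx` is the coefficient at `1` of `∏ m, A m (idx m)` (`NormalisedFrame.exists_eq_re_prod`,
`exists_matrix_or_quadraticAlgebra`).

In the second case, every sub-hyperdeterminant of `T` is `a ^ 2 * (b ^ 2 + 4 * a)` times a square
(`RealTensor.hyperdet_subtensor`). If the discriminant `b ^ 2 + 4 * a` is positive, the algebra is
`ℝ × ℝ` and `T` has rank at most two. If it is zero, the algebra is a limit of such, so that `T` has
border rank at most two. If it is negative, the algebra is `ℂ`; nonnegativity then makes all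
sub-hyperdeterminants vanish, so at most two modes carry vectors that are not real up to a complex
factor, and `T` is again a matrix times vectors. A positive sub-hyperdeterminant leaves only the
positive discriminant, which gives the last assertion. Conversely, sums of two decomposable tensors
satisfy both conditions, which are closed.
-/

/-! ### Functions of rank at most two and their quadratic algebra -/

section QuadraticStructure

variable {ι : Type*} [DecidableEq ι] {X : ι → Type*}

/-- A function on a product of sets has flattening rank at most two if, for every split of the
modes into two nonempty parts, all `3 × 3` minors of the associated matrix vanish. -/
def FlatteningRankLETwo (S : (∀ m, X m) → ℝ) : Prop :=
  ∀ I : Finset ι, I.Nonempty → (∃ j, j ∉ I) → ∀ x y : Fin 3 → ∀ m, X m,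
    (Matrix.of fun a b => S (I.piecewise (x a) (y b))).det = 0

/-- A normalised frame for `S` consists of a base point `v` with value `1`, and of a second point `w`
whose insertion in one of three marked modes `e 0, e 1, e 2` gives `0`; the values at double and
triple insertions are written in the form `γ λ_a λ_b` and `t λ_0 λ_1 λ_2` with nonzero `γ` and
`λ_a`, where `λ_a` is `l a`. -/
structure NormalisedFrame (S : (∀ m, X m) → ℝ) (v w : ∀ m, X m) (e : Fin 3 → ι)
    (l : Fin 3 → ℝ) (γ t : ℝ) : Prop where
  rank : FlatteningRankLETwo S
  inj : Function.Injective e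
  l_ne : ∀ a, l a ≠ 0
  γ_ne : γ ≠ 0
  base : S v = 1
  single : ∀ a, S (({e a} : Finset ι).piecewise w v) = 0
  double : ∀ a b, a ≠ b → S (({e a, e b} : Finset ι).piecewise w v) = γ * l a * l b
  triple : ∀ a b c, a ≠ b → a ≠ c → b ≠ c →
    S (({e a, e b, e c} : Finset ι).piecewise w v) = t * l a * l b * l c

/-- The vanishing of the `3 × 3` minor with rows `v`, `w` inserted in mode `i`, and `x`, and columns
`v`, `w` inserted in mode `j`, and `x`: the value at `x` is expressed through the values of the two
parts of `x` in the split `I`. -/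
theorem FlatteningRankLETwo.cross {S : (∀ m, X m) → ℝ} (h : FlatteningRankLETwo S)
    {v w : ∀ m, X m} (hv : S v = 1) {i j : ι} (hi : S (({i} : Finset ι).piecewise w v) = 0)
    (hj : S (({j} : Finset ι).piecewise w v) = 0) {I : Finset ι} (hiI : i ∈ I) (hjI : j ∉ I)
    (x : ∀ m, X m) :
    S (({i, j} : Finset ι).piecewise w v) * S x =
      S (({i, j} : Finset ι).piecewise w v) * S (I.piecewise x v) * S (I.piecewise v x) +
        S (I.piecewise x (({j} : Finset ι).piecewise w v)) *
          S (I.piecewise (({i} : Finset ι).piecewise w v) x) := by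
  have H := h I ⟨i, hiI⟩ ⟨j, hjI⟩ ![v, ({i} : Finset ι).piecewise w v, x]
    ![v, ({j} : Finset ι).piecewise w v, x]
  have e1 : I.piecewise v v = v := by
    funext m; simp only [Finset.piecewise]; grind
  have e2 : I.piecewise x x = x := by
    funext m; simp only [Finset.piecewise]; grind
  have e3 : I.piecewise (({i} : Finset ι).piecewise w v) v = ({i} : Finset ι).piecewise w v := by
    funext m; simp only [Finset.piecewise]; grind
  have e4 : I.piecewise v (({j} : Finset ι).piecewise w v) = ({j} : Finset ι).piecewise w v := by
    funext m; simp only [Finset.piecewise]; grind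
  have e5 : I.piecewise (({i} : Finset ι).piecewise w v) (({j} : Finset ι).piecewise w v) =
      ({i, j} : Finset ι).piecewise w v := by
    funext m; simp only [Finset.piecewise]; grind
  simp [Matrix.det_fin_three, e1, e2, e3, e4, e5, hv, hi, hj] at H
  linear_combination H

namespace NormalisedFrame

variable {S : (∀ m, X m) → ℝ} {v w : ∀ m, X m} {e : Fin 3 → ι} {l : Fin 3 → ℝ} {γ t : ℝ}

/-- The element `β` of the algebra `ℝ[ω]`, `ω² = γ + (t / γ) ω`, represents the insertion of `x` in
the modes of `J`: the values of `S` at this insertion, alone and together with an insertion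
of `w` in a further mode `e a`, are the coefficients at `1` of `β` and of `λ_a ω β`. -/
def Represents (S : (∀ m, X m) → ℝ) (v w : ∀ m, X m) (e : Fin 3 → ι) (l : Fin 3 → ℝ) (γ t : ℝ)
    (J : Finset ι) (x : ∀ m, X m) (β : QuadraticAlgebra ℝ γ (t / γ)) : Prop :=
  β.re = S (J.piecewise x v) ∧
    ∀ a, e a ∉ J → γ * l a * β.im = S (J.piecewise x (({e a} : Finset ι).piecewise w v))

theorem exists_ne_ne (a b : Fin 3) : ∃ c, c ≠ a ∧ c ≠ b := by
  revert a b; decide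

theorem cross (F : NormalisedFrame S v w e l γ t) {a b : Fin 3} {I : Finset ι}
    (ha : e a ∈ I) (hb : e b ∉ I) (x : ∀ m, X m) :
    γ * l a * l b * S x = γ * l a * l b * S (I.piecewise x v) * S (I.piecewise v x) +
        S (I.piecewise x (({e b} : Finset ι).piecewise w v)) *
          S (I.piecewise (({e a} : Finset ι).piecewise w v) x) := by
  have hab : a ≠ b := by rintro rfl; exact hb ha
  have := F.rank.cross F.base (F.single a) (F.single b) ha hb x
  rwa [F.double a b hab] at this

/-- The value of `S` at an insertion in two disjoint sets of modes is the pairing of the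
representatives, provided that the sets are separated by a split with marked modes on both
sides. -/
theorem re_mul_of_separated (F : NormalisedFrame S v w e l γ t) {J K I : Finset ι}
    {x : ∀ m, X m} {β β' : QuadraticAlgebra ℝ γ (t / γ)} (hJ : Represents S v w e l γ t J x β)
    (hK : Represents S v w e l γ t K x β') (hJI : J ⊆ I) (hKI : Disjoint K I) {a b : Fin 3}
    (ha : e a ∈ I) (hb : e b ∉ I) :
    S ((J ∪ K).piecewise x v) = (β * β').re := by
  have hK' : ∀ m ∈ K, m ∉ I := fun m hm => Finset.disjoint_left.mp hKI hm
  have hJ' : ∀ m ∈ J, m ∈ I := fun m hm => hJI hm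
  have H := F.cross ha hb ((J ∪ K).piecewise x v)
  have e1 : I.piecewise ((J ∪ K).piecewise x v) v = J.piecewise x v := by
    funext m; simp only [Finset.piecewise]; grind
  have e2 : I.piecewise v ((J ∪ K).piecewise x v) = K.piecewise x v := by
    funext m; simp only [Finset.piecewise]; grind
  have e3 : I.piecewise ((J ∪ K).piecewise x v) (({e b} : Finset ι).piecewise w v) =
      J.piecewise x (({e b} : Finset ι).piecewise w v) := by
    funext m; simp only [Finset.piecewise]; grind
  have e4 : I.piecewise (({e a} : Finset ι).piecewise w v) ((J ∪ K).piecewise x v) =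
      K.piecewise x (({e a} : Finset ι).piecewise w v) := by
    funext m; simp only [Finset.piecewise]; grind
  rw [e1, e2, e3, e4, ← hJ.1, ← hK.1, ← hJ.2 b (by grind), ← hK.2 a (by grind)] at H
  have h0 : γ * l a * l b ≠ 0 := mul_ne_zero (mul_ne_zero F.γ_ne (F.l_ne a)) (F.l_ne b)
  apply mul_left_cancel₀ h0
  rw [H, QuadraticAlgebra.re_mul]
  ring

/-- The value at an insertion of `w` in a marked mode outside `J`, divided by `λ_a`, does not depend
on the marked mode. -/
theorem insertion_indep (F : NormalisedFrame S v w e l γ t) {J : Finset ι} {x : ∀ m, X m}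
    {a b : Fin 3} (ha : e a ∉ J) (hb : e b ∉ J) :
    l b * S (J.piecewise x (({e a} : Finset ι).piecewise w v)) =
      l a * S (J.piecewise x (({e b} : Finset ι).piecewise w v)) := by
  by_cases hab : a = b
  · rw [hab]
  obtain ⟨c, hca, hcb⟩ := exists_ne_ne a b
  have na := F.inj.ne hca
  have nb := F.inj.ne hcb
  have nab := F.inj.ne hab
  have H := F.cross (a := c) (b := b) (I := insert (e c) J) (by grind) (by grind)
    (J.piecewise x (({e a} : Finset ι).piecewise w v))
  have e1 : (insert (e c) J).piecewise v (J.piecewise x (({e a} : Finset ι).piecewise w v)) =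
      ({e a} : Finset ι).piecewise w v := by
    funext m; simp only [Finset.piecewise]; grind
  have e2 : (insert (e c) J).piecewise (J.piecewise x (({e a} : Finset ι).piecewise w v))
      (({e b} : Finset ι).piecewise w v) = J.piecewise x (({e b} : Finset ι).piecewise w v) := by
    funext m; simp only [Finset.piecewise]; grind
  have e3 : (insert (e c) J).piecewise (({e c} : Finset ι).piecewise w v)
      (J.piecewise x (({e a} : Finset ι).piecewise w v)) =
      ({e c, e a} : Finset ι).piecewise w v := by
    funext m; simp only [Finset.piecewise]; grind
  rw [e1, e2, e3, F.single, F.double c a hca] at H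
  apply mul_left_cancel₀ (mul_ne_zero F.γ_ne (F.l_ne c))
  linear_combination H

/-- Every element of a single mode has a representative: at least two marked modes stay free, and by
`insertion_indep` either of them determines the second coordinate. -/
theorem exists_represents_singleton (F : NormalisedFrame S v w e l γ t) (m : ι) (p : X m) :
    ∃ β : QuadraticAlgebra ℝ γ (t / γ), ∀ x : ∀ m, X m, x m = p →
      Represents S v w e l γ t {m} x β := by
  obtain ⟨a, ha⟩ : ∃ a, e a ≠ m := by
    by_cases h : e 0 = m
    · exact ⟨1, fun h' => absurd (F.inj (h.trans h'.symm)) (by decide)⟩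
    · exact ⟨0, h⟩
  have key : ∀ (x : ∀ m, X m) (y : ∀ m, X m), x m = p →
      ({m} : Finset ι).piecewise x y = Function.update y m p := by
    rintro x y rfl
    exact Finset.piecewise_singleton x y m
  refine ⟨⟨S (Function.update v m p),
    S (Function.update (({e a} : Finset ι).piecewise w v) m p) / (γ * l a)⟩, fun x hx => ⟨?_, ?_⟩⟩
  · rw [key x _ hx]
  · intro b hb
    have := F.insertion_indep (x := x) (J := {m}) (a := a) (b := b) (by simpa using ha) hb
    rw [key x _ hx, key x _ hx] at this
    rw [key x _ hx]
    have h1 := F.γ_ne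
    have h2 := F.l_ne a
    field_simp
    linear_combination this

/-- Inserting `w` in a marked mode multiplies the representative by a multiple of `ω`. -/
theorem Represents.insert_marked (F : NormalisedFrame S v w e l γ t) {J : Finset ι}
    {x : ∀ m, X m} {β : QuadraticAlgebra ℝ γ (t / γ)} (hJ : Represents S v w e l γ t J x β)
    {c : Fin 3} (hc : e c ∉ J) (hx : x (e c) = w (e c)) :
    Represents S v w e l γ t (insert (e c) J) x (⟨0, l c⟩ * β) := by
  have hγ := F.γ_ne
  refine ⟨?_, fun b hb => ?_⟩
  · have e1 : (insert (e c) J).piecewise x v = J.piecewise x (({e c} : Finset ι).piecewise w v) := by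
      funext m; simp only [Finset.piecewise]; grind
    rw [e1, ← hJ.2 c hc, QuadraticAlgebra.re_mul]
    ring
  · have hcb : b ≠ c := by rintro rfl; exact hb (Finset.mem_insert_self _ _)
    obtain ⟨a, hab, hac⟩ := exists_ne_ne b c
    have nab := F.inj.ne hab
    have nac := F.inj.ne hac
    have nbc := F.inj.ne hcb
    have hbJ : e b ∉ J := fun h => hb (Finset.mem_insert_of_mem h)
    have H := F.cross (a := b) (b := a) (I := {e c, e b}) (by grind) (by grind)
      ((insert (e c) J).piecewise x (({e b} : Finset ι).piecewise w v))
    have e1 : ({e c, e b} : Finset ι).piecewise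
        ((insert (e c) J).piecewise x (({e b} : Finset ι).piecewise w v)) v =
        ({e c, e b} : Finset ι).piecewise w v := by
      funext m; simp only [Finset.piecewise]; grind
    have e2 : ({e c, e b} : Finset ι).piecewise v
        ((insert (e c) J).piecewise x (({e b} : Finset ι).piecewise w v)) = J.piecewise x v := by
      funext m; simp only [Finset.piecewise]; grind
    have e3 : ({e c, e b} : Finset ι).piecewise
        ((insert (e c) J).piecewise x (({e b} : Finset ι).piecewise w v))
        (({e a} : Finset ι).piecewise w v) = ({e a, e b, e c} : Finset ι).piecewise w v := by
      funext m; simp only [Finset.piecewise]; grind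
    have e4 : ({e c, e b} : Finset ι).piecewise (({e b} : Finset ι).piecewise w v)
        ((insert (e c) J).piecewise x (({e b} : Finset ι).piecewise w v)) =
        J.piecewise x (({e b} : Finset ι).piecewise w v) := by
      funext m; simp only [Finset.piecewise]; grind
    rw [e1, e2, e3, e4, F.double c b hcb.symm, F.triple a b c hab hac hcb, ← hJ.1,
      ← hJ.2 b hbJ] at H
    apply mul_left_cancel₀ (mul_ne_zero (mul_ne_zero hγ (F.l_ne b)) (F.l_ne a))
    rw [H, QuadraticAlgebra.im_mul]
    field_simp
    ring

/-- If some marked mode is free, two disjoint sets of modes can be separated by a split with marked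
modes on both sides. -/
theorem re_mul_of_not_mem (F : NormalisedFrame S v w e l γ t) {J K : Finset ι}
    {x : ∀ m, X m} {β β' : QuadraticAlgebra ℝ γ (t / γ)} (hJ : Represents S v w e l γ t J x β)
    (hK : Represents S v w e l γ t K x β') (hJK : Disjoint J K) {c : Fin 3} (hc : e c ∉ J ∪ K) :
    S ((J ∪ K).piecewise x v) = (β * β').re := by
  rw [Finset.disjoint_left] at hJK
  by_cases h : ∃ a, e a ∈ J
  · obtain ⟨a, ha⟩ := h
    exact F.re_mul_of_separated hJ hK subset_rfl (by rw [Finset.disjoint_right]; exact hJK) ha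
      (b := c) (by grind)
  · push Not at h
    obtain ⟨a, ha⟩ : ∃ a, a ≠ c := exists_ne c
    refine F.re_mul_of_separated hJ hK (I := insert (e c) J) (Finset.subset_insert _ _) ?_
      (Finset.mem_insert_self _ _) (b := a) ?_
    · rw [Finset.disjoint_right]; grind
    · have := F.inj.ne ha
      have := h a
      grind

/-- The value at an insertion in two disjoint sets of modes and of `w` in a further marked mode. This
mode is grouped with `K`, and a marked mode outside `K` with `J`. -/
theorem re_mul_insert (F : NormalisedFrame S v w e l γ t) {J K : Finset ι}
    {x : ∀ m, X m} {β β' : QuadraticAlgebra ℝ γ (t / γ)} (hJ : Represents S v w e l γ t J x β)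
    (hK : Represents S v w e l γ t K x β') (hJK : Disjoint J K) {c : Fin 3} (hc : e c ∉ J ∪ K)
    (hx : x (e c) = w (e c)) (h : ∃ a, a ≠ c ∧ e a ∉ K) :
    S ((insert (e c) (J ∪ K)).piecewise x v) = (⟨0, l c⟩ * (β * β')).re := by
  rw [Finset.disjoint_left] at hJK
  obtain ⟨a, hac, ha⟩ := h
  have nac := F.inj.ne hac
  have H := F.re_mul_of_separated (I := insert (e a) J) hJ
    (hK.insert_marked F (c := c) (by grind) hx) (Finset.subset_insert _ _)
    (by rw [Finset.disjoint_right]; grind) (Finset.mem_insert_self _ _) (b := c) (by grind)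
  rw [show insert (e c) (J ∪ K) = J ∪ insert (e c) K by grind, H]
  congr 1
  ring

theorem Represents.congr {J : Finset ι} {x y : ∀ m, X m} {β : QuadraticAlgebra ℝ γ (t / γ)}
    (hJ : Represents S v w e l γ t J x β) (h : ∀ m ∈ J, x m = y m) :
    Represents S v w e l γ t J y β := by
  have key : ∀ z : ∀ m, X m, J.piecewise y z = J.piecewise x z := by
    intro z; funext m; simp only [Finset.piecewise]; grind
  simpa only [Represents, key] using hJ

/-- Representatives of insertions in disjoint sets of modes multiply, as long as one of the marked
modes stays free. -/
theorem Represents.mul (F : NormalisedFrame S v w e l γ t) {J K : Finset ι}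
    {x : ∀ m, X m} {β β' : QuadraticAlgebra ℝ γ (t / γ)} (hJ : Represents S v w e l γ t J x β)
    (hK : Represents S v w e l γ t K x β') (hJK : Disjoint J K) (hc : ∃ c, e c ∉ J ∪ K) :
    Represents S v w e l γ t (J ∪ K) x (β * β') := by
  refine ⟨(F.re_mul_of_not_mem hJ hK hJK hc.choose_spec).symm, fun c hc => ?_⟩
  set y := Function.update x (e c) (w (e c)) with hy
  have hJ' := hJ.congr (y := y) fun m hm => by
    rw [hy, Function.update_of_ne]; rintro rfl; exact hc (Finset.mem_union_left _ hm)
  have hK' := hK.congr (y := y) fun m hm => by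
    rw [hy, Function.update_of_ne]; rintro rfl; exact hc (Finset.mem_union_right _ hm)
  have hyc : y (e c) = w (e c) := by simp [hy]
  have e1 : (J ∪ K).piecewise x (({e c} : Finset ι).piecewise w v) =
      (insert (e c) (J ∪ K)).piecewise y v := by
    funext m; simp only [Finset.piecewise, hy]; grind
  have H : S ((insert (e c) (J ∪ K)).piecewise y v) = (⟨0, l c⟩ * (β * β')).re := by
    by_cases h : ∃ a, a ≠ c ∧ e a ∉ K
    · exact F.re_mul_insert hJ' hK' hJK hc hyc h
    · rw [Finset.union_comm, mul_comm β]
      refine F.re_mul_insert hK' hJ' hJK.symm (by rwa [Finset.union_comm]) hyc ?_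
      rw [Finset.disjoint_left] at hJK
      obtain ⟨a, ha⟩ := exists_ne c
      exact ⟨a, ha, by grind⟩
  rw [e1, H, QuadraticAlgebra.re_mul]
  ring

/-- A function of flattening rank at most two with a normalised frame is the restriction of the
linear form `z ↦ z.re` of the quadratic algebra `ℝ[ω]`, `ω² = γ + (t / γ) ω`, applied to a
product of elements of the algebra. -/
theorem exists_eq_re_prod [Fintype ι] (F : NormalisedFrame S v w e l γ t) :
    ∃ a : ∀ m, X m → QuadraticAlgebra ℝ γ (t / γ), ∀ x, S x = (∏ m, a m (x m)).re := by
  choose a ha using F.exists_represents_singleton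
  refine ⟨a, fun x => ?_⟩
  have key : ∀ J : Finset ι, e 0 ∉ J → Represents S v w e l γ t J x (∏ m ∈ J, a m (x m)) := by
    intro J
    induction J using Finset.induction_on with
    | empty =>
      intro _
      refine ⟨by simp [F.base, QuadraticAlgebra.re_one], fun b _ => ?_⟩
      simpa [QuadraticAlgebra.im_one] using (F.single b).symm
    | insert m J hm ih =>
      intro h0
      rw [Finset.prod_insert hm, Finset.insert_eq]
      exact Represents.mul F (ha m (x m) x rfl) (ih fun h => h0 (Finset.mem_insert_of_mem h))
        (by simpa using hm) ⟨0, by rwa [← Finset.insert_eq]⟩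
  have H := F.re_mul_of_separated (I := {e 0}) (a := 0) (b := 1) (ha (e 0) (x (e 0)) x rfl)
    (key (Finset.univ.erase (e 0)) (by simp)) subset_rfl (by simp) (by simp)
    (by simpa using F.inj.ne (show (1 : Fin 3) ≠ 0 by decide))
  rw [Finset.mul_prod_erase _ (fun m => a m (x m)) (Finset.mem_univ (e 0))] at H
  rw [← H]
  congr 1
  funext m; simp only [Finset.piecewise]; grind

end NormalisedFrame

end QuadraticStructure

/-! ### Functions that are polynomial on lines -/

section PolynomialOnLines

variable {V : Type*} [AddCommGroup V] [Module ℝ V]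

/-- A real function on a vector space is polynomial on lines if its restriction to every affine
line is given by a polynomial in the parameter. -/
def PolynomialOnLines (f : V → ℝ) : Prop :=
  ∀ p q : V, ∃ P : Polynomial ℝ, ∀ t : ℝ, f (p + t • q) = P.eval t

theorem PolynomialOnLines.mul {f g : V → ℝ} (hf : PolynomialOnLines f)
    (hg : PolynomialOnLines g) : PolynomialOnLines fun x => f x * g x := fun p q => by
  obtain ⟨P, hP⟩ := hf p q
  obtain ⟨Q, hQ⟩ := hg p q
  exact ⟨P * Q, fun t => by simp [hP, hQ]⟩

theorem PolynomialOnLines.sub {f g : V → ℝ} (hf : PolynomialOnLines f)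
    (hg : PolynomialOnLines g) : PolynomialOnLines fun x => f x - g x := fun p q => by
  obtain ⟨P, hP⟩ := hf p q
  obtain ⟨Q, hQ⟩ := hg p q
  exact ⟨P - Q, fun t => by simp [hP, hQ]⟩

/-- Functions that are polynomial on lines have no zero divisors: on the line through a point
where `f` is nonzero and a point where `g` is nonzero, both have finitely many zeros. -/
theorem PolynomialOnLines.exists_ne_zero {f g : V → ℝ} (hf : PolynomialOnLines f)
    (hg : PolynomialOnLines g) (hf0 : ∃ x, f x ≠ 0) (hg0 : ∃ x, g x ≠ 0) :
    ∃ x, f x ≠ 0 ∧ g x ≠ 0 := by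
  obtain ⟨p, hp⟩ := hf0
  obtain ⟨q, hq⟩ := hg0
  obtain ⟨P, hP⟩ := hf p (q - p)
  obtain ⟨Q, hQ⟩ := hg p (q - p)
  have hP0 : P ≠ 0 := by
    rintro rfl
    exact hp (by simpa using hP 0)
  have hQ0 : Q ≠ 0 := by
    rintro rfl
    exact hq (by simpa using hQ 1)
  by_contra! h
  apply mul_ne_zero hP0 hQ0
  apply Polynomial.funext
  intro t
  by_cases ht : P.eval t = 0
  · simp [ht]
  · have := h _ (by rw [hP]; exact ht)
    rw [hQ] at this
    simp [this]

theorem MultilinearMap.polynomialOnLines_comp {ι : Type*} [Fintype ι] {E : ι → Type*}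
    [∀ m, AddCommGroup (E m)] [∀ m, Module ℝ (E m)] (F : MultilinearMap ℝ E ℝ)
    {L : V → ∀ m, E m} (hL : ∀ p q, ∃ c, ∀ t : ℝ, L (p + t • q) = L p + t • c) :
    PolynomialOnLines fun x => F (L x) := by
  classical
  intro p q
  obtain ⟨c, hc⟩ := hL p q
  refine ⟨∑ s : Finset ι, Polynomial.C (F (s.piecewise c (L p))) * Polynomial.X ^ s.card,
    fun t => ?_⟩
  beta_reduce
  rw [hc, add_comm, MultilinearMap.map_add_univ, Polynomial.eval_finsetSum]
  refine Finset.sum_congr rfl fun s _ => ?_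
  have := F.map_piecewise_smul (fun _ => t) (s.piecewise c (L p)) s
  have e : s.piecewise (t • c) (L p) =
      s.piecewise (fun i => (fun _ => t) i • s.piecewise c (L p) i) (s.piecewise c (L p)) := by
    funext m
    by_cases hm : m ∈ s <;> simp [hm]
  rw [e, this]
  simp only [Finset.prod_const, smul_eq_mul, Polynomial.eval_mul, Polynomial.eval_C,
    Polynomial.eval_pow, Polynomial.eval_X]
  ring

end PolynomialOnLines

/-! ### The graph of linked modes of a multilinear form -/

section LinkedModes

variable {ι : Type*} [DecidableEq ι] {E : ι → Type*}
  [∀ m, AddCommGroup (E m)] [∀ m, Module ℝ (E m)]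

/-- The `2 × 2` minor of a multilinear form in the modes `i` and `j` at the base point `v`, in the
directions of the components of `w`. -/
def pairMinor (F : MultilinearMap ℝ E ℝ) (i j : ι) (v w : ∀ m, E m) : ℝ :=
  F v * F (({i, j} : Finset ι).piecewise w v) -
    F (({i} : Finset ι).piecewise w v) * F (({j} : Finset ι).piecewise w v)

/-- Two distinct modes are linked if some slice of the multilinear form in these two modes, at a
decomposable argument in the others, is a matrix of rank at least two. -/
def Linked (F : MultilinearMap ℝ E ℝ) (i j : ι) : Prop :=
  i ≠ j ∧ ∃ v w, pairMinor F i j v w ≠ 0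

theorem Linked.symm {F : MultilinearMap ℝ E ℝ} {i j : ι} (h : Linked F i j) : Linked F j i := by
  obtain ⟨hij, v, w, hvw⟩ := h
  refine ⟨hij.symm, v, w, ?_⟩
  rwa [pairMinor, Finset.pair_comm, mul_comm (F (({j} : Finset ι).piecewise w v))]

variable (F : MultilinearMap ℝ E ℝ)

theorem polynomialOnLines_piecewise [Fintype ι] (K : Finset ι) :
    PolynomialOnLines fun z : (∀ m, E m) × (∀ m, E m) => F (K.piecewise z.2 z.1) := by
  apply F.polynomialOnLines_comp
  intro p q
  refine ⟨K.piecewise q.2 q.1, fun t => ?_⟩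
  funext m
  by_cases hm : m ∈ K <;> simp [hm]

theorem polynomialOnLines_fst [Fintype ι] :
    PolynomialOnLines fun z : (∀ m, E m) × (∀ m, E m) => F z.1 := by
  simpa using polynomialOnLines_piecewise F ∅

theorem polynomialOnLines_pairMinor [Fintype ι] (i j : ι) :
    PolynomialOnLines fun z : (∀ m, E m) × (∀ m, E m) => pairMinor F i j z.1 z.2 :=
  ((polynomialOnLines_fst F).mul (polynomialOnLines_piecewise F _)).sub
    ((polynomialOnLines_piecewise F _).mul (polynomialOnLines_piecewise F _))

theorem Linked.exists_ne {F : MultilinearMap ℝ E ℝ} {i j : ι} (h : Linked F i j) :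
    ∃ z : (∀ m, E m) × (∀ m, E m), pairMinor F i j z.1 z.2 ≠ 0 := by
  obtain ⟨-, v, w, h⟩ := h
  exact ⟨(v, w), h⟩

theorem exists_apply_ne_zero {F : MultilinearMap ℝ E ℝ} {i j : ι} (h : Linked F i j) :
    ∃ z : (∀ m, E m) × (∀ m, E m), F z.1 ≠ 0 := by
  by_contra! h0
  have h0' : ∀ v, F v = 0 := fun v => h0 (v, v)
  obtain ⟨-, v, w, h⟩ := h
  simp [pairMinor, h0'] at h

theorem map_piecewise_update_add_smul {K : Finset ι} {i : ι} (hi : i ∉ K) (v w : ∀ m, E m)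
    (s : ℝ) :
    F (K.piecewise w (Function.update v i (v i + s • w i))) =
      F (K.piecewise w v) + s * F ((insert i K).piecewise w v) := by
  have e1 : K.piecewise w (Function.update v i (v i + s • w i)) =
      Function.update (K.piecewise w v) i (v i + s • w i) := by
    funext m
    rcases eq_or_ne m i with rfl | hm
    · simp [hi]
    · by_cases hmK : m ∈ K <;> simp [hm, hmK]
  have e2 : Function.update (K.piecewise w v) i (v i) = K.piecewise w v := by
    rw [Function.update_eq_self_iff]
    simp [hi]
  rw [e1, F.map_update_add, F.map_update_smul, e2, ← Finset.piecewise_insert, smul_eq_mul]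

/-- Linking is transitive. If the minors in the modes `j, k` vanished identically, then so would
those at the base points obtained by moving `v i` in the direction of `w i`; comparing
coefficients gives that the product of the minors in `i, j` and in `i, k` is zero. -/
theorem Linked.trans [Fintype ι] {F : MultilinearMap ℝ E ℝ} {i j k : ι} (hij : Linked F i j)
    (hik : Linked F i k) (hjk : j ≠ k) : Linked F j k := by
  refine ⟨hjk, ?_⟩
  by_contra! h
  obtain ⟨⟨v, w⟩, h1, h2⟩ := (polynomialOnLines_pairMinor F i j).exists_ne_zero
    (polynomialOnLines_pairMinor F i k) hij.exists_ne hik.exists_ne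
  have key : ∀ s : ℝ, (F v + s * F (({i} : Finset ι).piecewise w v)) *
      (F (({j, k} : Finset ι).piecewise w v) + s * F (({i, j, k} : Finset ι).piecewise w v)) -
      (F (({j} : Finset ι).piecewise w v) + s * F (({i, j} : Finset ι).piecewise w v)) *
      (F (({k} : Finset ι).piecewise w v) + s * F (({i, k} : Finset ι).piecewise w v)) = 0 := by
    intro s
    have H := h (Function.update v i (v i + s • w i)) w
    have hi : i ≠ j := hij.1
    have hi' : i ≠ k := hik.1
    have e0 := map_piecewise_update_add_smul F (K := ∅) (i := i) (by simp) v w s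
    rw [pairMinor, map_piecewise_update_add_smul F (by simp [hi, hi']),
      map_piecewise_update_add_smul F (by simp [hi]),
      map_piecewise_update_add_smul F (by simp [hi'])] at H
    simp only [Finset.piecewise_empty] at e0
    rw [e0] at H
    exact H
  have k0 := key 0
  have k1 := key 1
  have k2 := key (-1)
  refine mul_ne_zero h1 h2 ?_
  simp only [pairMinor]
  set A := F v
  set Ai := F (({i} : Finset ι).piecewise w v)
  set Aj := F (({j} : Finset ι).piecewise w v)
  set Ak := F (({k} : Finset ι).piecewise w v)
  set Aij := F (({i, j} : Finset ι).piecewise w v)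
  set Aik := F (({i, k} : Finset ι).piecewise w v)
  set Ajk := F (({j, k} : Finset ι).piecewise w v)
  set Aijk := F (({i, j, k} : Finset ι).piecewise w v)
  have c1 : A * Aijk + Ai * Ajk - Aj * Aik - Aij * Ak = 0 := by linear_combination (k1 - k2) / 2
  have c2 : Ai * Aijk - Aij * Aik = 0 := by linear_combination (k1 + k2) / 2 - k0
  linear_combination -A ^ 2 * c2 + A * Ai * c1 - Ai ^ 2 * k0

/-- For a form of flattening rank at most two, two disjoint pairs of linked modes are linked to each
other: otherwise, the flattening that separates both pairs has a nonzero `3 × 3` minor. -/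
theorem Linked.of_disjoint [Fintype ι] {F : MultilinearMap ℝ E ℝ} (hF : FlatteningRankLETwo F)
    {i j k l : ι} (hij : Linked F i j) (hkl : Linked F k l) (hjk : j ≠ k)
    (hil : i ≠ l) : Linked F i l := by
  refine ⟨hil, ?_⟩
  obtain ⟨⟨v, w⟩, h1, h2⟩ := (polynomialOnLines_pairMinor F i j).exists_ne_zero
    (polynomialOnLines_pairMinor F k l) hij.exists_ne hkl.exists_ne
  obtain ⟨⟨v, w⟩, ⟨h1, h2⟩, h3⟩ : ∃ z : (∀ m, E m) × (∀ m, E m),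
      (pairMinor F i j z.1 z.2 ≠ 0 ∧ pairMinor F k l z.1 z.2 ≠ 0) ∧ F z.1 ≠ 0 := by
    simpa only [mul_ne_zero_iff] using ((polynomialOnLines_pairMinor F i j).mul
      (polynomialOnLines_pairMinor F k l)).exists_ne_zero (polynomialOnLines_fst F)
      ⟨(v, w), mul_ne_zero h1 h2⟩ (exists_apply_ne_zero hij)
  have hij' := hij.1
  have hkl' := hkl.1
  have H := hF {i, k} ⟨i, by simp⟩ ⟨j, by simp [hij'.symm, hjk]⟩
    ![v, ({i} : Finset ι).piecewise w v, ({k} : Finset ι).piecewise w v]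
    ![v, ({j} : Finset ι).piecewise w v, ({l} : Finset ι).piecewise w v]
  have e1 : ({i, k} : Finset ι).piecewise v v = v := by
    funext m; simp only [Finset.piecewise]; grind
  have e2 : ∀ a ∈ ({i, k} : Finset ι), ({i, k} : Finset ι).piecewise
      (({a} : Finset ι).piecewise w v) v = ({a} : Finset ι).piecewise w v := by
    intro a ha; funext m; simp only [Finset.piecewise]; grind
  have e3 : ∀ b ∉ ({i, k} : Finset ι), ({i, k} : Finset ι).piecewise v
      (({b} : Finset ι).piecewise w v) = ({b} : Finset ι).piecewise w v := by
    intro b hb; funext m; simp only [Finset.piecewise]; grind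
  have e4 : ∀ a ∈ ({i, k} : Finset ι), ∀ b ∉ ({i, k} : Finset ι), ({i, k} : Finset ι).piecewise
      (({a} : Finset ι).piecewise w v) (({b} : Finset ι).piecewise w v) =
        ({a, b} : Finset ι).piecewise w v := by
    intro a ha b hb; funext m; simp only [Finset.piecewise]; grind
  have mi : i ∈ ({i, k} : Finset ι) := by simp
  have mk : k ∈ ({i, k} : Finset ι) := by simp
  have mj : j ∉ ({i, k} : Finset ι) := by grind
  have ml : l ∉ ({i, k} : Finset ι) := by grind
  simp only [Matrix.det_fin_three, Matrix.of_apply, Matrix.cons_val, e1, e2 i mi, e2 k mk, e3 j mj,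
    e3 l ml, e4 i mi j mj, e4 i mi l ml, e4 k mk j mj, e4 k mk l ml] at H
  refine ⟨v, w, fun h0 => mul_ne_zero h1 h2 ?_⟩
  simp only [pairMinor] at h0 ⊢
  linear_combination (F v) * H + (F v * F (({k, j} : Finset ι).piecewise w v) -
    F (({k} : Finset ι).piecewise w v) * F (({j} : Finset ι).piecewise w v)) * h0

/-- A mode that is not linked to any other mode splits off as a factor. -/
theorem apply_mul_apply_of_not_linked [Fintype ι] {m : ι} (hm : ∀ l, ¬ Linked F m l)
    (p p' : E m) (y y' : ∀ m, E m) :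
    F (Function.update y m p) * F (Function.update y' m p') =
      F (Function.update y m p') * F (Function.update y' m p) := by
  have step : ∀ (p p' : E m) (y y' : ∀ m, E m) (l : ι),
      F (Function.update y m p) * F (Function.update (Function.update y l (y' l)) m p') =
        F (Function.update y m p') * F (Function.update (Function.update y l (y' l)) m p) := by
    intro p p' y y' l
    rcases eq_or_ne l m with rfl | hl
    · simp [mul_comm]
    have H : pairMinor F m l (Function.update y m p) (Function.update y' m p') = 0 := by
      by_contra h
      exact hm l ⟨hl.symm, _, _, h⟩
    have e1 : ({m, l} : Finset ι).piecewise (Function.update y' m p') (Function.update y m p) =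
        Function.update (Function.update y l (y' l)) m p' := by
      funext a; simp only [Finset.piecewise, Function.update]; grind
    have e2 : ({m} : Finset ι).piecewise (Function.update y' m p') (Function.update y m p) =
        Function.update y m p' := by
      funext a; simp only [Finset.piecewise, Function.update]; grind
    have e3 : ({l} : Finset ι).piecewise (Function.update y' m p') (Function.update y m p) =
        Function.update (Function.update y l (y' l)) m p := by
      funext a; simp only [Finset.piecewise, Function.update]; grind
    rw [pairMinor, e1, e2, e3] at H
    linear_combination H
  -- The modes are moved from `y` to `y'` one at a time; this is possible at a generic point,
  -- where the intermediate values are nonzero.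
  have key : ∀ J : Finset ι, ∀ y y' : ∀ m, E m,
      F (Function.update y m p) * F (Function.update (J.piecewise y' y) m p') =
        F (Function.update y m p') * F (Function.update (J.piecewise y' y) m p) := by
    have hpoly : ∀ (J : Finset ι) (q : E m), PolynomialOnLines
        fun z : (∀ m, E m) × (∀ m, E m) => F (Function.update (J.piecewise z.2 z.1) m q) := by
      intro J q
      apply F.polynomialOnLines_comp
      intro a b
      refine ⟨Function.update (J.piecewise b.2 b.1) m 0, fun t => ?_⟩
      funext n
      rcases eq_or_ne n m with rfl | hn
      · simp
      · by_cases hnJ : n ∈ J <;> simp [hn, hnJ]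
    intro J
    induction J using Finset.induction_on with
    | empty => intro y y'; simp [mul_comm]
    | insert l J hl ih =>
      intro y y'
      by_contra h
      have hD : PolynomialOnLines fun z : (∀ m, E m) × (∀ m, E m) =>
          F (Function.update z.1 m p) *
            F (Function.update ((insert l J).piecewise z.2 z.1) m p') -
          F (Function.update z.1 m p') *
            F (Function.update ((insert l J).piecewise z.2 z.1) m p) := by
        have h0 := hpoly ∅
        simp only [Finset.piecewise_empty] at h0
        exact ((h0 p).mul (hpoly _ p')).sub ((h0 p').mul (hpoly _ p))
      by_cases hp : ∃ z : (∀ m, E m) × (∀ m, E m),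
          F (Function.update (J.piecewise z.2 z.1) m p) ≠ 0
      · obtain ⟨⟨u, u'⟩, h1, h2⟩ := hD.exists_ne_zero (hpoly J p) ⟨(y, y'), sub_ne_zero.mpr h⟩ hp
        refine mul_ne_zero h1 h2 ?_
        have i1 := ih u u'
        have i2 := step p p' (J.piecewise u' u) u' l
        simp only [← Finset.piecewise_insert] at i2
        linear_combination F (Function.update ((insert l J).piecewise u' u) m p) * i1 +
          F (Function.update u m p) * i2
      · push Not at hp
        have h0 : ∀ y, F (Function.update y m p) = 0 := fun y => by
          simpa [Finset.piecewise_same] using hp (y, y)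
        simp [h0] at h
  simpa using key Finset.univ y y'

end LinkedModes

/-! ### Classification of multilinear forms of flattening rank at most two -/

/-- A function of two variables with vanishing `3 × 3` minors is a sum of two products. -/
theorem exists_eq_add_of_det_eq_zero {α β : Type*} (M : α → β → ℝ)
    (hM : ∀ (p : Fin 3 → α) (q : Fin 3 → β), (Matrix.of fun a b => M (p a) (q b)).det = 0) :
    ∃ (f f' : α → ℝ) (g g' : β → ℝ), ∀ p q, M p q = f p * g q + f' p * g' q := by
  by_cases h0 : ∀ p q, M p q = 0
  · exact ⟨0, 0, 0, 0, by simp [h0]⟩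
  push Not at h0
  obtain ⟨p0, q0, h0⟩ := h0
  by_cases h1 : ∀ p q, M p0 q0 * M p q - M p q0 * M p0 q = 0
  · refine ⟨fun p => M p q0 / M p0 q0, 0, fun q => M p0 q, 0, fun p q => ?_⟩
    have := h1 p q
    simp only [Pi.zero_apply]
    field_simp
    linear_combination this
  push Not at h1
  obtain ⟨p1, q1, h1⟩ := h1
  refine ⟨fun p => M p q0 / M p0 q0,
    fun p => (M p0 q0 * M p q1 - M p q0 * M p0 q1) / M p0 q0,
    fun q => M p0 q,
    fun q => (M p0 q0 * M p1 q - M p1 q0 * M p0 q) / (M p0 q0 * M p1 q1 - M p1 q0 * M p0 q1),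
    fun p q => ?_⟩
  have H := hM ![p0, p1, p] ![q0, q1, q]
  simp only [Matrix.det_fin_three, Matrix.of_apply, Matrix.cons_val] at H
  rw [div_mul_eq_mul_div, div_mul_div_comm, div_add_div _ _ h0 (mul_ne_zero h0 h1),
    eq_div_iff (mul_ne_zero h0 (mul_ne_zero h0 h1))]
  linear_combination (M p0 q0) ^ 2 * H

section Classification

variable {ι : Type*} [DecidableEq ι] [Fintype ι] {E : ι → Type*}
  [∀ m, AddCommGroup (E m)] [∀ m, Module ℝ (E m)]

/-- If at most two modes are linked to other modes, then all other modes split off, and the form is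
a matrix of rank at most two times a product of linear forms. -/
theorem exists_eq_add_mul_prod_of_not_linked {F : MultilinearMap ℝ E ℝ}
    (hF : FlatteningRankLETwo F) {i j : ι} (hij : i ≠ j)
    (h : ∀ m, m ≠ i → m ≠ j → ∀ l, ¬ Linked F m l) :
    ∃ (f f' : E i → ℝ) (g g' : E j → ℝ) (r : ∀ m, E m → ℝ), ∀ x,
      F x = (f (x i) * g (x j) + f' (x i) * g' (x j)) *
        ∏ m ∈ Finset.univ \ {i, j}, r m (x m) := by
  by_cases h0 : ∀ v, F v = 0
  · exact ⟨0, 0, 0, 0, 0, by simp [h0]⟩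
  push Not at h0
  obtain ⟨v, hv⟩ := h0
  obtain ⟨f, f', g, g', hM⟩ := exists_eq_add_of_det_eq_zero
    (fun p q => F (Function.update (Function.update v i p) j q)) (by
      intro p q
      have H := hF {i} ⟨i, by simp⟩ ⟨j, by simpa using hij.symm⟩
        (fun a => Function.update v i (p a)) (fun b => Function.update v j (q b))
      convert H using 6 with a b
      funext m; simp only [Finset.piecewise, Function.update]; grind)
  refine ⟨f, f', g, g', fun m q => F (Function.update v m q) / F v, fun x => ?_⟩
  have key : ∀ J : Finset ι, i ∉ J → j ∉ J →
      F x = F (J.piecewise v x) * ∏ m ∈ J, (F (Function.update v m (x m)) / F v) := by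
    intro J
    induction J using Finset.induction_on with
    | empty => intro _ _; simp
    | insert m J hm ih =>
      intro hi hj
      rw [ih (fun h => hi (Finset.mem_insert_of_mem h)) (fun h => hj (Finset.mem_insert_of_mem h)),
        Finset.prod_insert hm, Finset.piecewise_insert]
      have H := apply_mul_apply_of_not_linked F (h m (by rintro rfl; simp at hi)
        (by rintro rfl; simp at hj)) (x m) (v m) (J.piecewise v x) v
      have e : Function.update (J.piecewise v x) m (x m) = J.piecewise v x := by
        rw [Function.update_eq_self_iff]
        simp [hm]
      rw [e, Function.update_eq_self] at H
      field_simp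
      linear_combination (∏ m ∈ J, (F (Function.update v m (x m)) / F v)) * H
  rw [key (Finset.univ \ {i, j}) (by simp) (by simp), ← hM]
  congr 2
  funext m; simp only [Finset.piecewise, Function.update]; grind

/-- Three mutually linked modes yield a normalised frame: at a generic base point, the vectors of
the three modes are corrected by multiples of the base point. -/
theorem exists_normalisedFrame {F : MultilinearMap ℝ E ℝ} (hF : FlatteningRankLETwo F)
    {i j k : ι} (hij : Linked F i j) (hik : Linked F i k) (hjk : Linked F j k) :
    ∃ (τ : ℝ) (v w : ∀ m, E m) (l : Fin 3 → ℝ) (γ t : ℝ), τ ≠ 0 ∧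
      NormalisedFrame (fun x => F x / τ) v w ![i, j, k] l γ t := by
  have nij := hij.1
  have nik := hik.1
  have njk := hjk.1
  obtain ⟨z₁, hz₁⟩ := (polynomialOnLines_pairMinor F i j).exists_ne_zero
    (polynomialOnLines_pairMinor F i k) hij.exists_ne hik.exists_ne
  obtain ⟨z₂, hz₂⟩ := (polynomialOnLines_pairMinor F j k).exists_ne_zero
    (polynomialOnLines_fst F) hjk.exists_ne (exists_apply_ne_zero hij)
  obtain ⟨⟨v, w⟩, h1, h2⟩ := PolynomialOnLines.exists_ne_zero
    ((polynomialOnLines_pairMinor F i j).mul (polynomialOnLines_pairMinor F i k))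
    ((polynomialOnLines_pairMinor F j k).mul (polynomialOnLines_fst F))
    ⟨z₁, mul_ne_zero hz₁.1 hz₁.2⟩ ⟨z₂, mul_ne_zero hz₂.1 hz₂.2⟩
  obtain ⟨hmij, hmik⟩ := mul_ne_zero_iff.mp h1
  obtain ⟨hmjk, hv⟩ := mul_ne_zero_iff.mp h2
  simp only at hmij hmik hmjk hv
  set w' : ∀ m, E m := fun m => w m - (F (({m} : Finset ι).piecewise w v) / F v) • v m with hw'
  -- Inserting the corrected vector in a further mode.
  have step : ∀ (m : ι) (y : ∀ m, E m), F (Function.update y m (w' m)) =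
      F (Function.update y m (w m)) -
        F (({m} : Finset ι).piecewise w v) / F v * F (Function.update y m (v m)) := by
    intro m y
    rw [hw', F.map_update_sub, F.map_update_smul, smul_eq_mul]
  have single : ∀ m, F (({m} : Finset ι).piecewise w' v) = 0 := by
    intro m
    rw [Finset.piecewise_singleton, step, Function.update_eq_self, Finset.piecewise_singleton]
    field_simp
    ring
  have double : ∀ m n, m ≠ n →
      F (({m, n} : Finset ι).piecewise w' v) = pairMinor F m n v w / F v := by
    intro m n hmn
    have e1 : Function.update (({n} : Finset ι).piecewise w' v) m (v m) =
        ({n} : Finset ι).piecewise w' v := by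
      rw [Function.update_eq_self_iff]
      simp [hmn]
    have e2 : Function.update (({n} : Finset ι).piecewise w' v) m (w m) =
        Function.update (Function.update v m (w m)) n (w' n) := by
      rw [Finset.piecewise_singleton, Function.update_comm hmn.symm]
    have e3 : Function.update (Function.update v m (w m)) n (w n) =
        ({m, n} : Finset ι).piecewise w v := by
      rw [Finset.piecewise_insert, Finset.piecewise_singleton, Function.update_comm hmn]
    have e4 : Function.update (Function.update v m (w m)) n (v n) =
        ({m} : Finset ι).piecewise w v := by
      rw [Finset.piecewise_singleton, Function.update_eq_self_iff]
      simp [hmn.symm]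
    rw [Finset.piecewise_insert, step, e1, single, e2, step, e3, e4, pairMinor]
    field_simp
    ring
  -- The values at double insertions; solving `c_ab = γ λ_a λ_b` with `λ_0 = 1`.
  set c : ι → ι → ℝ := fun m n => F (({m, n} : Finset ι).piecewise w' v) / F v with hc
  have csymm : ∀ m n, c m n = c n m := fun m n => by
    simp only [hc]
    rw [Finset.pair_comm]
  have cne : ∀ m n, m ≠ n → pairMinor F m n v w ≠ 0 → c m n ≠ 0 := by
    intro m n hmn h
    simp only [hc, double m n hmn]
    exact div_ne_zero (div_ne_zero h hv) hv
  have cij := cne i j nij hmij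
  have cik := cne i k nik hmik
  have cjk := cne j k njk hmjk
  set l : Fin 3 → ℝ := ![1, c j k / c i k, c j k / c i j] with hl
  have hl0 : ∀ a, l a ≠ 0 := by
    intro a
    fin_cases a <;> simp [hl, cij, cik, cjk]
  have hinj : Function.Injective ![i, j, k] := by
    intro a b hab
    fin_cases a <;> fin_cases b <;> simp_all
  refine ⟨F v, v, w', l, c i j * c i k / c j k,
    F ((Finset.univ.image ![i, j, k]).piecewise w' v) / F v / ∏ a, l a, hv, ?_⟩
  refine ⟨?_, hinj, hl0, div_ne_zero (mul_ne_zero cij cik) cjk, div_self hv, ?_, ?_, ?_⟩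
  · intro I h h' x y
    have e : (Matrix.of fun a b : Fin 3 => F (I.piecewise (x a) (y b)) / F v) =
        (F v)⁻¹ • (Matrix.of fun a b : Fin 3 => F (I.piecewise (x a) (y b))) := by
      ext a b
      simp [div_eq_inv_mul]
    rw [e, Matrix.det_smul, hF I h h' x y, mul_zero]
  · intro a
    simp [single]
  · intro a b hab
    change c (![i, j, k] a) (![i, j, k] b) = _
    fin_cases a <;> fin_cases b <;> simp [hl] at hab ⊢ <;>
      first
      | (field_simp; done)
      | (rw [csymm]; field_simp)
  · intro a b d hab had hbd
    have e : ({a, b, d} : Finset (Fin 3)) = Finset.univ := by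
      revert a b d; decide
    have e1 : ({![i, j, k] a, ![i, j, k] b, ![i, j, k] d} : Finset ι) =
        Finset.univ.image ![i, j, k] := by
      rw [← e]; simp [Finset.image_insert]
    have e2 : l a * l b * l d = ∏ a, l a := by
      rw [← e, Finset.prod_insert (by simp [hab, had]), Finset.prod_pair hbd, mul_assoc]
    have e3 : ∏ a, l a ≠ 0 := Finset.prod_ne_zero_iff.mpr fun a _ => hl0 a
    rw [e1, mul_assoc, mul_assoc, ← mul_assoc (l a), e2, div_mul_cancel₀ _ e3]

/-- A multilinear form of flattening rank at most two is a matrix of rank at most two times a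
product of functions of one mode each, or it is given by multiplication in a quadratic algebra. The
second case occurs as soon as some mode is linked to two others. -/
theorem exists_matrix_or_quadraticAlgebra {F : MultilinearMap ℝ E ℝ}
    (hF : FlatteningRankLETwo F) (hι : 2 ≤ Fintype.card ι) :
    (∃ i j, i ≠ j ∧ ∃ (f f' : E i → ℝ) (g g' : E j → ℝ) (r : ∀ m, E m → ℝ), ∀ x,
      F x = (f (x i) * g (x j) + f' (x i) * g' (x j)) *
        ∏ m ∈ Finset.univ \ {i, j}, r m (x m)) ∨
    ∃ (a b : ℝ) (A : ∀ m, E m → QuadraticAlgebra ℝ a b), ∀ x, F x = (∏ m, A m (x m)).re := by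
  by_cases h3 : ∃ i j k, Linked F i j ∧ Linked F i k ∧ j ≠ k
  · right
    obtain ⟨i, j, k, hij, hik, hjk⟩ := h3
    obtain ⟨τ, v, w, l, γ, t, hτ, N⟩ := exists_normalisedFrame hF hij hik (hij.trans hik hjk)
    obtain ⟨A, hA⟩ := N.exists_eq_re_prod
    refine ⟨γ, t / γ, fun m y => (if m = i then ⟨τ, 0⟩ else 1) * A m y, fun x => ?_⟩
    rw [Finset.prod_mul_distrib, Finset.prod_ite_eq' Finset.univ i, if_pos (Finset.mem_univ i),
      QuadraticAlgebra.re_mul, ← hA]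
    field_simp
    ring
  · left
    push Not at h3
    by_cases h2 : ∃ i j, Linked F i j
    · obtain ⟨i, j, hij⟩ := h2
      refine ⟨i, j, hij.1, exists_eq_add_mul_prod_of_not_linked hF hij.1 fun m hmi hmj l hml => ?_⟩
      rcases eq_or_ne l i with rfl | hli
      · exact hmj (h3 _ _ _ hml.symm hij)
      · have hjl : j ≠ l := by
          rintro rfl
          exact hmi (h3 _ _ _ hml.symm hij.symm)
        exact hmj (h3 _ _ _ (hij.of_disjoint hF hml.symm hjl hmi.symm) hij)
    · push Not at h2
      obtain ⟨i, j, hij⟩ := Fintype.exists_pair_of_one_lt_card (α := ι) (by omega)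
      exact ⟨i, j, hij, exists_eq_add_mul_prod_of_not_linked hF hij fun m _ _ l => h2 m l⟩

end Classification

/-! ### Flattenings of tensors -/

theorem Matrix.rank_le_two_of_eq_add {α β : Type*} [Fintype α] [Fintype β] (A : Matrix α β ℝ)
    (f f' : α → ℝ) (g g' : β → ℝ) (h : ∀ p q, A p q = f p * g q + f' p * g' q) : A.rank ≤ 2 := by
  have e : A = (Matrix.of fun p (s : Fin 2) => ![f p, f' p] s) *
      (Matrix.of fun (s : Fin 2) q => ![g q, g' q] s) := by
    ext p q
    simp [Matrix.mul_apply, h]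
  rw [e]
  exact (Matrix.rank_mul_le_right _ _).trans ((Matrix.rank_le_card_height _).trans (by simp))

theorem Matrix.rank_le_two_iff {α β : Type*} [Fintype α] [Fintype β] (A : Matrix α β ℝ) :
    A.rank ≤ 2 ↔ ∀ (p : Fin 3 → α) (q : Fin 3 → β), (A.submatrix p q).det = 0 := by
  constructor
  · intro h p q
    by_contra hdet
    have h3 := Matrix.rank_of_isUnit (A.submatrix p q)
      ((Matrix.isUnit_iff_isUnit_det _).mpr (isUnit_iff_ne_zero.mpr hdet))
    have := Matrix.rank_submatrix_le A p q
    rw [Fintype.card_fin] at h3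
    omega
  · intro h
    obtain ⟨f, f', g, g', hA⟩ := exists_eq_add_of_det_eq_zero (fun p q => A p q) h
    exact A.rank_le_two_of_eq_add f f' g g' hA

namespace RealTensor

variable {d : ℕ} {n : Fin d → ℕ}

/-- The multilinear form whose coefficients are the entries of the tensor `T`. -/
noncomputable def toMultilinearMap (T : RealTensor n) :
    MultilinearMap ℝ (fun m : Fin d => Fin (n m) → ℝ) ℝ :=
  ∑ idx, T idx • (MultilinearMap.mkPiAlgebra ℝ (Fin d) ℝ).compLinearMap
    fun m => LinearMap.proj (idx m)

theorem toMultilinearMap_apply (T : RealTensor n) (v : ∀ m : Fin d, Fin (n m) → ℝ) :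
    T.toMultilinearMap v = ∑ idx, T idx * ∏ m, v m (idx m) := by
  simp [toMultilinearMap]

theorem toMultilinearMap_single (T : RealTensor n) (idx : ∀ m : Fin d, Fin (n m)) :
    T.toMultilinearMap (fun m => Pi.single (idx m) 1) = T idx := by
  rw [toMultilinearMap_apply, Finset.sum_eq_single idx]
  · simp
  · intro j _ hj
    obtain ⟨m, hm⟩ := Function.ne_iff.mp hj
    rw [Finset.prod_eq_zero (Finset.mem_univ m), mul_zero]
    simp [hm]
  · simp

theorem prod_eq_prod_mul_prod_compl (I : Finset (Fin d)) (f : Fin d → ℝ) :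
    ∏ m, f m = (∏ m : {m // m ∈ I}, f m) * ∏ m : {m // m ∉ I}, f m := by
  rw [← Fintype.prod_subtype_mul_prod_subtype (fun m => m ∈ I)]
  congr!

theorem flatteningRankLETwo_toMultilinearMap {T : RealTensor n}
    (hT : ∀ r ∈ flatteningRanks T, r ≤ 2) : FlatteningRankLETwo T.toMultilinearMap := by
  intro I hI hI' x y
  have hr : (flattening T I).rank ≤ 2 :=
    hT _ ⟨I, hI, by obtain ⟨j, hj⟩ := hI'; exact ⟨j, by simpa using hj⟩, rfl⟩
  by_contra hdet
  have e : (Matrix.of fun a b => T.toMultilinearMap (I.piecewise (x a) (y b))) =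
      (Matrix.of fun (a : Fin 3) (r : ∀ m : {m // m ∈ I}, Fin (n m)) => ∏ m : {m // m ∈ I}, x a m (r m)) *
        flattening T I *
        (Matrix.of fun (c : ∀ m : {m // m ∉ I}, Fin (n m)) (b : Fin 3) => ∏ m : {m // m ∉ I}, y b m (c m)) := by
    ext a b
    rw [Matrix.of_apply, toMultilinearMap_apply, Matrix.mul_apply,
      ← (Equiv.piEquivPiSubtypeProd (fun m => m ∈ I) (fun m => Fin (n m))).symm.sum_comp,
      Fintype.sum_prod_type_right]
    refine Finset.sum_congr rfl fun c _ => ?_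
    rw [Matrix.mul_apply, Finset.sum_mul]
    refine Finset.sum_congr rfl fun r _ => ?_
    rw [prod_eq_prod_mul_prod_compl I]
    have e1 : ∀ m : {m // m ∈ I}, I.piecewise (x a) (y b) m
        ((Equiv.piEquivPiSubtypeProd (fun m => m ∈ I) (fun m => Fin (n m))).symm (r, c) m) =
        x a m (r m) := by
      intro m
      simp [Equiv.piEquivPiSubtypeProd]
    have e2 : ∀ m : {m // m ∉ I}, I.piecewise (x a) (y b) m
        ((Equiv.piEquivPiSubtypeProd (fun m => m ∈ I) (fun m => Fin (n m))).symm (r, c) m) =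
        y b m (c m) := by
      intro m
      simp [Equiv.piEquivPiSubtypeProd, m.2]
    simp only [e1, e2]
    simp only [Matrix.of_apply, flattening, Equiv.piEquivPiSubtypeProd,
      Equiv.coe_fn_symm_mk]
    ring
  have h3 := Matrix.rank_of_isUnit _
    ((Matrix.isUnit_iff_isUnit_det _).mpr (isUnit_iff_ne_zero.mpr hdet))
  rw [e, Fintype.card_fin] at h3
  have h1 := (Matrix.rank_mul_le_left ((Matrix.of fun (a : Fin 3)
    (r : ∀ m : {m // m ∈ I}, Fin (n m)) => ∏ m : {m // m ∈ I}, x a m (r m)) * flattening T I)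
    (Matrix.of fun (c : ∀ m : {m // m ∉ I}, Fin (n m)) (b : Fin 3) => ∏ m : {m // m ∉ I}, y b m (c m)))
  have h2 := Matrix.rank_mul_le_right (Matrix.of fun (a : Fin 3)
    (r : ∀ m : {m // m ∈ I}, Fin (n m)) => ∏ m : {m // m ∈ I}, x a m (r m)) (flattening T I)
  omega

theorem rank_flattening_le {T : RealTensor n} {r : ℕ} (hT : IsSumOfDecomposables T r)
    (I : Finset (Fin d)) : (flattening T I).rank ≤ r := by
  obtain ⟨x, hx, rfl⟩ := hT
  choose v hv using hx
  have e : flattening (∑ s, x s) I =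
      (Matrix.of fun (a : ∀ m : {m // m ∈ I}, Fin (n m)) (s : Fin r) => ∏ m : {m // m ∈ I}, v s m (a m)) *
        (Matrix.of fun (s : Fin r) (b : ∀ m : {m // m ∉ I}, Fin (n m)) => ∏ m : {m // m ∉ I}, v s m (b m)) := by
    ext a b
    rw [Matrix.mul_apply, flattening, Finset.sum_apply]
    refine Finset.sum_congr rfl fun s _ => ?_
    rw [← hv, decomposable, prod_eq_prod_mul_prod_compl I]
    congr 1
    · exact Finset.prod_congr rfl fun m _ => by simp
    · exact Finset.prod_congr rfl fun m _ => by simp [m.2]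
  rw [e]
  exact (Matrix.rank_mul_le_right _ _).trans ((Matrix.rank_le_card_height _).trans (by simp))

/-- Rank at most two is the vanishing of the `3 × 3` minors, which are continuous. -/
theorem isClosed_rank_flattening_le_two (I : Finset (Fin d)) :
    IsClosed {S : RealTensor n | (flattening S I).rank ≤ 2} := by
  simp only [Matrix.rank_le_two_iff, Set.ofPred_forall]
  refine isClosed_iInter fun p => isClosed_iInter fun q => isClosed_eq ?_ continuous_const
  refine Continuous.matrix_det (continuous_matrix fun a b => ?_)
  exact continuous_apply _

/-! ### Rank and border rank -/

theorem IsSumOfDecomposables.mono (hd : 0 < d) {T : RealTensor n} {r s : ℕ}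
    (hT : IsSumOfDecomposables T r) (hrs : r ≤ s) : IsSumOfDecomposables T s := by
  obtain ⟨k, rfl⟩ := Nat.exists_eq_add_of_le hrs
  obtain ⟨x, hx, rfl⟩ := hT
  have h0 : (0 : RealTensor n) ∈ segreCone n := by
    refine ⟨0, ?_⟩
    funext idx
    exact Finset.prod_eq_zero (Finset.mem_univ ⟨0, hd⟩) rfl
  refine ⟨Fin.append x fun _ => 0, fun s => ?_, by simp [Fin.sum_univ_add]⟩
  refine Fin.addCases (fun s => ?_) (fun s => ?_) s
  · simpa using hx s
  · simpa using h0

theorem realRank_le_iff (hd : 0 < d) (T : RealTensor n) (r : ℕ) :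
    realRank T ≤ r ↔ IsSumOfDecomposables T r :=
  ⟨fun h => IsSumOfDecomposables.mono hd (Nat.sInf_mem (exists_isSumOfDecomposables hd T)) h,
    fun h => Nat.sInf_le h⟩

theorem realBorderRank_le_iff (hd : 0 < d) (T : RealTensor n) (r : ℕ) :
    realBorderRank T ≤ r ↔ T ∈ closure {S : RealTensor n | IsSumOfDecomposables S r} := by
  simp only [← realRank_le_iff hd]
  refine ⟨fun h => ?_, fun h => Nat.sInf_le h⟩
  have := Nat.sInf_mem (exists_mem_closure_realRank_le T)
  exact closure_mono (fun S hS => le_trans hS h) this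

theorem isSumOfDecomposables_two {T : RealTensor n} (v v' : ∀ m : Fin d, Fin (n m) → ℝ)
    (h : ∀ idx, T idx = ∏ m, v m (idx m) + ∏ m, v' m (idx m)) : IsSumOfDecomposables T 2 := by
  refine ⟨![decomposable v, decomposable v'], fun s => ?_, ?_⟩
  · fin_cases s
    exacts [⟨v, rfl⟩, ⟨v', rfl⟩]
  · funext idx
    simp [decomposable, h]

theorem IsSumOfDecomposables.exists_two {T : RealTensor n} (h : IsSumOfDecomposables T 2) :
    ∃ v v' : ∀ m : Fin d, Fin (n m) → ℝ, ∀ idx, T idx = ∏ m, v m (idx m) + ∏ m, v' m (idx m) := by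
  obtain ⟨x, hx, rfl⟩ := h
  obtain ⟨v, hv⟩ := hx 0
  obtain ⟨v', hv'⟩ := hx 1
  refine ⟨v, v', fun idx => ?_⟩
  simp [Fin.sum_univ_two, ← hv, ← hv', decomposable]

theorem prod_update_update (r : ∀ m : Fin d, Fin (n m) → ℝ) {i j : Fin d} (hij : i ≠ j)
    (f : Fin (n i) → ℝ) (g : Fin (n j) → ℝ) (idx : ∀ m : Fin d, Fin (n m)) :
    ∏ m, Function.update (Function.update r i f) j g m (idx m) =
      f (idx i) * g (idx j) * ∏ m ∈ Finset.univ \ {i, j}, r m (idx m) := by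
  rw [← Finset.prod_sdiff (Finset.subset_univ {i, j}), Finset.prod_pair hij, mul_comm]
  congr 1
  · simp [hij]
  · refine Finset.prod_congr rfl fun m hm => ?_
    simp only [Finset.mem_sdiff, Finset.mem_univ, true_and, Finset.mem_insert,
      Finset.mem_singleton, not_or] at hm
    rw [Function.update_of_ne hm.2, Function.update_of_ne hm.1]

theorem isSumOfDecomposables_two_of_eq_mul_prod {T : RealTensor n} {i j : Fin d} (hij : i ≠ j)
    (f f' : Fin (n i) → ℝ) (g g' : Fin (n j) → ℝ) (r : ∀ m : Fin d, Fin (n m) → ℝ)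
    (h : ∀ idx, T idx = (f (idx i) * g (idx j) + f' (idx i) * g' (idx j)) *
      ∏ m ∈ Finset.univ \ {i, j}, r m (idx m)) : IsSumOfDecomposables T 2 := by
  refine isSumOfDecomposables_two (Function.update (Function.update r i f) j g)
    (Function.update (Function.update r i f') j g') fun idx => ?_
  rw [prod_update_update r hij, prod_update_update r hij, h]
  ring

theorem isSumOfDecomposables_two_or_quadraticAlgebra (hd : 2 ≤ d) {T : RealTensor n}
    (hT : ∀ r ∈ flatteningRanks T, r ≤ 2) :
    IsSumOfDecomposables T 2 ∨
      ∃ (a b : ℝ) (A : ∀ m : Fin d, Fin (n m) → QuadraticAlgebra ℝ a b),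
        ∀ idx, T idx = (∏ m, A m (idx m)).re := by
  rcases exists_matrix_or_quadraticAlgebra (flatteningRankLETwo_toMultilinearMap hT)
    (by simpa using hd) with ⟨i, j, hij, f, f', g, g', r, h⟩ | ⟨a, b, A, h⟩
  · left
    refine isSumOfDecomposables_two_of_eq_mul_prod hij (fun p => f (Pi.single p 1))
      (fun p => f' (Pi.single p 1)) (fun p => g (Pi.single p 1)) (fun p => g' (Pi.single p 1))
      (fun m p => r m (Pi.single p 1)) fun idx => ?_
    rw [← toMultilinearMap_single T, h]
  · right
    refine ⟨a, b, fun m p => A m (Pi.single p 1), fun idx => ?_⟩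
    rw [← toMultilinearMap_single T, h]

/-! ### Sub-hyperdeterminants -/

theorem hyperdet_slot_one (g : Fin 2 → Fin 2 → ℝ) (x : Fin 2 → Fin 2 → Fin 2 → ℝ) :
    hyperdet (fun a b c => g a 0 * x 0 b c + g a 1 * x 1 b c) =
      (g 0 0 * g 1 1 - g 0 1 * g 1 0) ^ 2 * hyperdet x := by
  simp only [hyperdet]
  ring

theorem hyperdet_slot_two (g : Fin 2 → Fin 2 → ℝ) (x : Fin 2 → Fin 2 → Fin 2 → ℝ) :
    hyperdet (fun a b c => g b 0 * x a 0 c + g b 1 * x a 1 c) =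
      (g 0 0 * g 1 1 - g 0 1 * g 1 0) ^ 2 * hyperdet x := by
  simp only [hyperdet]
  ring

theorem hyperdet_slot_three (g : Fin 2 → Fin 2 → ℝ) (x : Fin 2 → Fin 2 → Fin 2 → ℝ) :
    hyperdet (fun a b c => g c 0 * x a b 0 + g c 1 * x a b 1) =
      (g 0 0 * g 1 1 - g 0 1 * g 1 0) ^ 2 * hyperdet x := by
  simp only [hyperdet]
  ring

/-- The hyperdeterminant is invariant, up to squares of determinants, under base change in each
factor. -/
theorem hyperdet_base_change (g h k : Fin 2 → Fin 2 → ℝ) (x : Fin 2 → Fin 2 → Fin 2 → ℝ) :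
    hyperdet (fun a b c => ∑ p, ∑ q, ∑ r, g a p * h b q * k c r * x p q r) =
      (g 0 0 * g 1 1 - g 0 1 * g 1 0) ^ 2 * (h 0 0 * h 1 1 - h 0 1 * h 1 0) ^ 2 *
        (k 0 0 * k 1 1 - k 0 1 * k 1 0) ^ 2 * hyperdet x := by
  rw [mul_assoc, mul_assoc, ← hyperdet_slot_three k, ← hyperdet_slot_two h, ← hyperdet_slot_one g]
  congr 1
  funext a b c
  simp only [Fin.sum_univ_two]
  ring

/-- The determinant of the coordinates of two elements of a quadratic algebra. -/
def coordDet {a b : ℝ} (z z' : QuadraticAlgebra ℝ a b) : ℝ := z.re * z'.im - z.im * z'.re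

/-- The hyperdeterminant of the multiplication tensor of a quadratic algebra is the
discriminant `b ^ 2 + 4 * a` times a square. -/
theorem hyperdet_re_mul {a b : ℝ} (α β γ : Fin 2 → QuadraticAlgebra ℝ a b) :
    hyperdet (fun p q r => (α p * β q * γ r).re) =
      a ^ 2 * (b ^ 2 + 4 * a) *
        (coordDet (α 0) (α 1) * coordDet (β 0) (β 1) * coordDet (γ 0) (γ 1)) ^ 2 := by
  have H := hyperdet_base_change (fun p => ![(α p).re, (α p).im]) (fun p => ![(β p).re, (β p).im])
    (fun p => ![(γ p).re, (γ p).im])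
    (fun p q r => ((![⟨1, 0⟩, ⟨0, 1⟩] : Fin 2 → QuadraticAlgebra ℝ a b) p *
      (![⟨1, 0⟩, ⟨0, 1⟩] : Fin 2 → QuadraticAlgebra ℝ a b) q *
      (![⟨1, 0⟩, ⟨0, 1⟩] : Fin 2 → QuadraticAlgebra ℝ a b) r).re)
  have e : (fun p q r => (α p * β q * γ r).re) = fun a' b' c' => ∑ p, ∑ q, ∑ r,
      (![(α a').re, (α a').im] : Fin 2 → ℝ) p * (![(β b').re, (β b').im] : Fin 2 → ℝ) q *
        (![(γ c').re, (γ c').im] : Fin 2 → ℝ) r *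
        ((![⟨1, 0⟩, ⟨0, 1⟩] : Fin 2 → QuadraticAlgebra ℝ a b) p *
      (![⟨1, 0⟩, ⟨0, 1⟩] : Fin 2 → QuadraticAlgebra ℝ a b) q *
      (![⟨1, 0⟩, ⟨0, 1⟩] : Fin 2 → QuadraticAlgebra ℝ a b) r).re := by
    funext p q r
    simp [Fin.sum_univ_two]
    ring
  rw [e, H]
  simp [hyperdet, coordDet]
  ring

/-- The hyperdeterminant of a sum of two decomposable `2 × 2 × 2` tensors is a square. -/
theorem hyperdet_add_nonneg (c c' : ℝ) (u v w u' v' w' : Fin 2 → ℝ) :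
    0 ≤ hyperdet fun p q r => c * u p * v q * w r + c' * u' p * v' q * w' r := by
  have H : (hyperdet fun p q r => c * u p * v q * w r + c' * u' p * v' q * w' r) =
      (c * c' * (u 0 * u' 1 - u' 0 * u 1) * (v 0 * v' 1 - v' 0 * v 1) *
        (w 0 * w' 1 - w' 0 * w 1)) ^ 2 := by
    simp only [hyperdet]
    ring
  rw [H]
  positivity

theorem prod_update_three {M : Type*} [CommMonoid M] (f : ∀ m : Fin d, Fin (n m) → M)
    {i j k : Fin d} (hij : i < j) (hjk : j < k) (base : ∀ m : Fin d, Fin (n m)) (x : Fin (n i))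
    (y : Fin (n j)) (z : Fin (n k)) :
    ∏ m, f m (Function.update (Function.update (Function.update base i x) j y) k z m) =
      (∏ m ∈ Finset.univ \ {i, j, k}, f m (base m)) * f i x * f j y * f k z := by
  have hik := hij.trans hjk
  rw [← Finset.prod_sdiff (Finset.subset_univ {i, j, k}),
    Finset.prod_insert (by simp [hij.ne, hik.ne]), Finset.prod_pair hjk.ne, ← mul_assoc,
    ← mul_assoc]
  congr 1
  · congr 1
    · congr 1
      · refine Finset.prod_congr rfl fun m hm => ?_
        simp only [Finset.mem_sdiff, Finset.mem_univ, true_and, Finset.mem_insert,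
          Finset.mem_singleton, not_or] at hm
        rw [Function.update_of_ne hm.2.2, Function.update_of_ne hm.2.1, Function.update_of_ne hm.1]
      · simp [hij.ne, hik.ne]
    · simp [hjk.ne]
  · simp

theorem hyperdet_subtensor_nonneg {T : RealTensor n} (hT : IsSumOfDecomposables T 2)
    (base : ∀ m : Fin d, Fin (n m)) {i j k : Fin d} (hij : i < j) (hjk : j < k)
    (p : Fin 2 → Fin (n i)) (q : Fin 2 → Fin (n j)) (r : Fin 2 → Fin (n k)) :
    0 ≤ hyperdet (subtensor T base i j k p q r) := by
  obtain ⟨v, v', h⟩ := hT.exists_two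
  have e : subtensor T base i j k p q r = fun a b c =>
      (∏ m ∈ Finset.univ \ {i, j, k}, v m (base m)) * v i (p a) * v j (q b) * v k (r c) +
      (∏ m ∈ Finset.univ \ {i, j, k}, v' m (base m)) * v' i (p a) * v' j (q b) * v' k (r c) := by
    funext a b c
    rw [subtensor, h, prod_update_three v hij hjk, prod_update_three v' hij hjk]
  rw [e]
  exact hyperdet_add_nonneg _ _ (fun a => v i (p a)) (fun a => v j (q a)) (fun a => v k (r a))
    (fun a => v' i (p a)) (fun a => v' j (q a)) (fun a => v' k (r a))

theorem isClosed_hyperdet_subtensor_nonneg (base : ∀ m : Fin d, Fin (n m)) (i j k : Fin d)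
    (p : Fin 2 → Fin (n i)) (q : Fin 2 → Fin (n j)) (r : Fin 2 → Fin (n k)) :
    IsClosed {S : RealTensor n | 0 ≤ hyperdet (subtensor S base i j k p q r)} := by
  refine isClosed_le continuous_const ?_
  simp only [hyperdet, subtensor]
  fun_prop

theorem coordDet_mul {a b : ℝ} (l z z' : QuadraticAlgebra ℝ a b) :
    coordDet (l * z) (l * z') = l.norm * coordDet z z' := by
  simp [coordDet, QuadraticAlgebra.norm_def]
  ring

theorem hyperdet_subtensor {T : RealTensor n} {a b : ℝ}
    {A : ∀ m : Fin d, Fin (n m) → QuadraticAlgebra ℝ a b}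
    (hA : ∀ idx, T idx = (∏ m, A m (idx m)).re) (base : ∀ m : Fin d, Fin (n m)) {i j k : Fin d}
    (hij : i < j) (hjk : j < k) (p : Fin 2 → Fin (n i)) (q : Fin 2 → Fin (n j))
    (r : Fin 2 → Fin (n k)) :
    hyperdet (subtensor T base i j k p q r) = a ^ 2 * (b ^ 2 + 4 * a) *
      ((∏ m ∈ Finset.univ \ {i, j, k}, (A m (base m)).norm) *
        coordDet (A i (p 0)) (A i (p 1)) * coordDet (A j (q 0)) (A j (q 1)) *
        coordDet (A k (r 0)) (A k (r 1))) ^ 2 := by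
  have e : subtensor T base i j k p q r = fun x y z =>
      ((∏ m ∈ Finset.univ \ {i, j, k}, A m (base m)) * A i (p x) * A j (q y) * A k (r z)).re := by
    funext x y z
    rw [subtensor, hA, prod_update_three A hij hjk]
  rw [e]
  have := hyperdet_re_mul (fun x => (∏ m ∈ Finset.univ \ {i, j, k}, A m (base m)) * A i (p x))
    (fun y => A j (q y)) (fun z => A k (r z))
  rw [this, coordDet_mul, map_prod]

end RealTensor

/-! ### Tensors given by multiplication in a quadratic algebra -/

namespace RealTensor

variable {d : ℕ} {n : Fin d → ℕ}

/-- If `ρ` is a root of `ω ^ 2 = a + b * ω`, then `ω ↦ ρ` is multiplicative. -/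
def evalRoot {a b : ℝ} (ρ : ℝ) (hρ : ρ ^ 2 = a + b * ρ) : QuadraticAlgebra ℝ a b →* ℝ where
  toFun z := z.re + ρ * z.im
  map_one' := by simp [QuadraticAlgebra.re_one, QuadraticAlgebra.im_one]
  map_mul' z z' := by
    simp only [QuadraticAlgebra.re_mul, QuadraticAlgebra.im_mul]
    linear_combination -(z.im * z'.im) * hρ

/-- Positive discriminant: the algebra is `ℝ × ℝ`, and the coefficient at `1` is a linear
combination of the two projections. -/
theorem isSumOfDecomposables_two_of_disc_pos (hd : 0 < d) {T : RealTensor n} {a b : ℝ}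
    {A : ∀ m : Fin d, Fin (n m) → QuadraticAlgebra ℝ a b}
    (hA : ∀ idx, T idx = (∏ m, A m (idx m)).re) (hab : 0 < b ^ 2 + 4 * a) :
    IsSumOfDecomposables T 2 := by
  have hs : √(b ^ 2 + 4 * a) ^ 2 = b ^ 2 + 4 * a := Real.sq_sqrt hab.le
  have hs0 : √(b ^ 2 + 4 * a) ≠ 0 := (Real.sqrt_pos.mpr hab).ne'
  set s := √(b ^ 2 + 4 * a)
  set e₁ := evalRoot (a := a) (b := b) ((b + s) / 2) (by linear_combination hs / 4)
  set e₂ := evalRoot (a := a) (b := b) ((b - s) / 2) (by linear_combination hs / 4)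
  have he : ∀ z, z.re = (s - b) / (2 * s) * e₁ z + (b + s) / (2 * s) * e₂ z := by
    intro z
    change z.re = (s - b) / (2 * s) * (z.re + (b + s) / 2 * z.im) +
      (b + s) / (2 * s) * (z.re + (b - s) / 2 * z.im)
    field_simp
    ring
  let z : Fin d := ⟨0, hd⟩
  refine isSumOfDecomposables_two
    (fun m p => (if m = z then (s - b) / (2 * s) else 1) * e₁ (A m p))
    (fun m p => (if m = z then (b + s) / (2 * s) else 1) * e₂ (A m p)) fun idx => ?_
  rw [hA, he, Finset.prod_mul_distrib, Finset.prod_mul_distrib, Finset.prod_ite_eq',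
    Finset.prod_ite_eq', if_pos (Finset.mem_univ z), if_pos (Finset.mem_univ z), map_prod, map_prod]

theorem continuous_prod_quadraticAlgebra {ι : Type*} (u w : ι → ℝ) (a b : ℝ) (J : Finset ι) :
    (Continuous fun δ : ℝ => (∏ m ∈ J, (⟨u m, w m⟩ : QuadraticAlgebra ℝ (a + δ) b)).re) ∧
      Continuous fun δ : ℝ => (∏ m ∈ J, (⟨u m, w m⟩ : QuadraticAlgebra ℝ (a + δ) b)).im := by
  classical
  induction J using Finset.induction_on with
  | empty =>
    simp only [Finset.prod_empty, QuadraticAlgebra.re_one, QuadraticAlgebra.im_one]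
    exact ⟨continuous_const, continuous_const⟩
  | insert m J hm ih =>
    obtain ⟨h1, h2⟩ := ih
    simp only [Finset.prod_insert hm, QuadraticAlgebra.re_mul, QuadraticAlgebra.im_mul]
    constructor <;> fun_prop

/-- Vanishing discriminant: the algebra of dual numbers is a limit of algebras isomorphic to
`ℝ × ℝ`. -/
theorem mem_closure_of_disc_eq_zero (hd : 0 < d) {T : RealTensor n} {a b : ℝ}
    {A : ∀ m : Fin d, Fin (n m) → QuadraticAlgebra ℝ a b}
    (hA : ∀ idx, T idx = (∏ m, A m (idx m)).re) (hab : b ^ 2 + 4 * a = 0) :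
    T ∈ closure {S : RealTensor n | IsSumOfDecomposables S 2} := by
  set S : ℝ → RealTensor n := fun δ idx =>
    (∏ m, (⟨(A m (idx m)).re, (A m (idx m)).im⟩ : QuadraticAlgebra ℝ (a + δ) b)).re with hS
  have hcont : Continuous S := continuous_pi fun idx =>
    (continuous_prod_quadraticAlgebra (fun m => (A m (idx m)).re) (fun m => (A m (idx m)).im)
      a b Finset.univ).1
  have h0 : S 0 = T := by
    -- The algebra itself depends on `δ`, so `a + 0` is replaced by `a` in its type.
    obtain ⟨a', ha'⟩ : ∃ a', a' = a + 0 := ⟨_, rfl⟩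
    funext idx
    simp only [hS]
    rw [← ha']
    obtain rfl : a' = a := by rw [ha', add_zero]
    rw [hA]
  have hlim : Filter.Tendsto S (nhdsWithin 0 (Set.Ioi 0)) (nhds T) := by
    rw [← h0]
    exact hcont.continuousAt.tendsto.mono_left nhdsWithin_le_nhds
  refine mem_closure_of_tendsto hlim ?_
  filter_upwards [self_mem_nhdsWithin] with δ hδ
  have hδ' : (0 : ℝ) < δ := hδ
  exact isSumOfDecomposables_two_of_disc_pos hd
    (A := fun m p => ⟨(A m p).re, (A m p).im⟩) (fun idx => rfl) (by linarith)

theorem norm_pos_of_disc_neg {a b : ℝ} (hab : b ^ 2 + 4 * a < 0) {z : QuadraticAlgebra ℝ a b}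
    (hz : z ≠ 0) : 0 < z.norm := by
  rw [QuadraticAlgebra.norm_def]
  by_cases him : z.im = 0
  · have hre : z.re ≠ 0 := fun hre => hz (QuadraticAlgebra.ext hre him)
    have := pow_pos (abs_pos.mpr hre) 2
    rw [sq_abs] at this
    simp only [him]
    nlinarith
  · have := pow_pos (abs_pos.mpr him) 2
    rw [sq_abs] at this
    nlinarith [sq_nonneg (2 * z.re + b * z.im)]

theorem exists_eq_smul_of_coordDet_eq_zero {a b : ℝ} {z z' : QuadraticAlgebra ℝ a b} (hz : z ≠ 0)
    (h : coordDet z z' = 0) : ∃ c : ℝ, z' = c • z := by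
  simp only [coordDet] at h
  by_cases hre : z.re = 0
  · have him : z.im ≠ 0 := fun him => hz (QuadraticAlgebra.ext hre him)
    refine ⟨z'.im / z.im, QuadraticAlgebra.ext ?_ ?_⟩
    · simp only [QuadraticAlgebra.re_smul, smul_eq_mul]
      field_simp
      linear_combination -h
    · simp only [QuadraticAlgebra.im_smul, smul_eq_mul]
      field_simp
  · refine ⟨z'.re / z.re, QuadraticAlgebra.ext ?_ ?_⟩
    · simp only [QuadraticAlgebra.re_smul, smul_eq_mul]
      field_simp
    · simp only [QuadraticAlgebra.im_smul, smul_eq_mul]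
      field_simp
      linear_combination h

/-- Negative discriminant: the algebra is `ℂ`, and no sub-hyperdeterminant is positive. If none is
negative either, then in all but two modes the vectors are real up to a common factor, and
the tensor is a matrix of rank at most two times real vectors. -/
theorem isSumOfDecomposables_two_of_disc_neg (hd : 2 ≤ d) {T : RealTensor n} {a b : ℝ}
    {A : ∀ m : Fin d, Fin (n m) → QuadraticAlgebra ℝ a b}
    (hA : ∀ idx, T idx = (∏ m, A m (idx m)).re) (hab : b ^ 2 + 4 * a < 0)
    (hT : ∀ δ ∈ subHyperdets T, 0 ≤ δ) : IsSumOfDecomposables T 2 := by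
  classical
  by_cases hT0 : ∀ idx, T idx = 0
  · exact isSumOfDecomposables_two 0 0 fun idx => by
      rw [hT0, Finset.prod_eq_zero (Finset.mem_univ (⟨0, by omega⟩ : Fin d)) rfl,
        add_zero]
  push Not at hT0
  obtain ⟨base, hbase⟩ := hT0
  have hA0 : ∀ m, A m (base m) ≠ 0 := by
    intro m hm
    apply hbase
    rw [hA, Finset.prod_eq_zero (Finset.mem_univ m) hm, QuadraticAlgebra.re_zero]
  -- The modes in which the vectors are not proportional to a real vector.
  set N : Finset (Fin d) := Finset.univ.filter fun m =>
    ∃ p q, p < q ∧ coordDet (A m p) (A m q) ≠ 0 with hN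
  have hcard : N.card ≤ 2 := by
    by_contra! h3
    set f := N.orderEmbOfFin rfl
    have hf : ∀ s, ∃ p q, p < q ∧ coordDet (A (f s) p) (A (f s) q) ≠ 0 := fun s =>
      (Finset.mem_filter.mp (N.orderEmbOfFin_mem rfl s)).2
    obtain ⟨p, p', hp, hpD⟩ := hf ⟨0, by omega⟩
    obtain ⟨q, q', hq, hqD⟩ := hf ⟨1, by omega⟩
    obtain ⟨r, r', hr, hrD⟩ := hf ⟨2, by omega⟩
    have h01 : f ⟨0, by omega⟩ < f ⟨1, by omega⟩ := f.strictMono (by simp)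
    have h12 : f ⟨1, by omega⟩ < f ⟨2, by omega⟩ := f.strictMono (by simp)
    have H := hT _ ⟨base, _, _, _, ![p, p'], ![q, q'], ![r, r'], h01, h12, hp, hq, hr, rfl⟩
    rw [hyperdet_subtensor hA base h01 h12] at H
    have hnorm : ∏ m ∈ Finset.univ \ {f ⟨0, by omega⟩, f ⟨1, by omega⟩, f ⟨2, by omega⟩},
        (A m (base m)).norm ≠ 0 :=
      Finset.prod_ne_zero_iff.mpr fun m _ => (norm_pos_of_disc_neg hab (hA0 m)).ne'
    have hpos := pow_pos (abs_pos.mpr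
      (mul_ne_zero (mul_ne_zero (mul_ne_zero hnorm hpD) hqD) hrD)) 2
    rw [sq_abs] at hpos
    have ha : a ≠ 0 := by
      rintro rfl
      nlinarith [sq_nonneg b]
    have hneg : a ^ 2 * (b ^ 2 + 4 * a) < 0 := mul_neg_of_pos_of_neg (by positivity) hab
    exact absurd H (not_le.mpr (mul_neg_of_neg_of_pos hneg hpos))
  obtain ⟨M, hNM, hM⟩ := Finset.exists_superset_card_eq hcard (by simpa using hd)
  obtain ⟨i, j, hij, rfl⟩ := Finset.card_eq_two.mp hM
  have hreal : ∀ m, m ∉ ({i, j} : Finset (Fin d)) → ∀ p, ∃ c : ℝ, A m p = c • A m (base m) := by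
    intro m hm p
    refine exists_eq_smul_of_coordDet_eq_zero (hA0 m) ?_
    have hmN : m ∉ N := fun h => hm (hNM h)
    simp only [hN, Finset.mem_filter, Finset.mem_univ, true_and, not_exists, not_and,
      not_not] at hmN
    rcases lt_trichotomy p (base m) with h | h | h
    · have := hmN _ _ h
      simp only [coordDet] at this ⊢
      linear_combination -this
    · rw [h, coordDet]
      ring
    · exact hmN _ _ h
  have hreal' : ∀ m p, ∃ c : ℝ, m ∉ ({i, j} : Finset (Fin d)) → A m p = c • A m (base m) := by
    intro m p
    by_cases hm : m ∈ ({i, j} : Finset (Fin d))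
    · exact ⟨0, fun h => absurd hm h⟩
    · obtain ⟨c, hc⟩ := hreal m hm p
      exact ⟨c, fun _ => hc⟩
  choose c hc using hreal'
  set U := ∏ m ∈ Finset.univ \ {i, j}, A m (base m)
  refine isSumOfDecomposables_two_of_eq_mul_prod hij (fun p => (U * A i p).re)
    (fun p => a * (U * A i p).im) (fun q => (A j q).re) (fun q => (A j q).im) c fun idx => ?_
  have hprod : ∏ m ∈ Finset.univ \ {i, j}, A m (idx m) =
      (∏ m ∈ Finset.univ \ {i, j}, c m (idx m)) • U := by
    rw [← Finset.prod_smul]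
    exact Finset.prod_congr rfl fun m hm => hc m _ (by simpa using hm)
  rw [hA, ← Finset.prod_sdiff (Finset.subset_univ {i, j}), Finset.prod_pair hij, hprod,
    smul_mul_assoc, QuadraticAlgebra.re_smul, ← mul_assoc, QuadraticAlgebra.re_mul, smul_eq_mul]
  ring

end RealTensor

theorem mainTheorem2 {d : ℕ} (hd : 3 ≤ d) (n : Fin d → ℕ) (T : RealTensor n) :
    (RealTensor.realBorderRank T ≤ 2 ↔
      (∀ r ∈ RealTensor.flatteningRanks T, r ≤ 2) ∧
        ∀ δ ∈ RealTensor.subHyperdets T, 0 ≤ δ) ∧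
    (RealTensor.realBorderRank T ≤ 2 →
      (∃ r ∈ RealTensor.flatteningRanks T, r = 2) →
      (∃ δ ∈ RealTensor.subHyperdets T, 0 < δ) →
      RealTensor.realRank T = 2) := by
  have hd0 : 0 < d := by omega
  have hd2 : 2 ≤ d := by omega
  have hflat : RealTensor.realBorderRank T ≤ 2 → ∀ r ∈ RealTensor.flatteningRanks T, r ≤ 2 := by
    rintro h r ⟨I, -, -, rfl⟩
    rw [RealTensor.realBorderRank_le_iff hd0] at h
    exact closure_minimal (fun S hS => RealTensor.rank_flattening_le hS I)
      (RealTensor.isClosed_rank_flattening_le_two I) h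
  refine ⟨⟨fun h => ⟨hflat h, ?_⟩, fun h => ?_⟩, fun h hrank hdet => ?_⟩
  · rintro δ ⟨base, i, j, k, p, q, r, hij, hjk, -, -, -, rfl⟩
    rw [RealTensor.realBorderRank_le_iff hd0] at h
    exact closure_minimal
      (fun S hS => RealTensor.hyperdet_subtensor_nonneg hS base hij hjk p q r)
      (RealTensor.isClosed_hyperdet_subtensor_nonneg base i j k p q r) h
  · rw [RealTensor.realBorderRank_le_iff hd0]
    rcases RealTensor.isSumOfDecomposables_two_or_quadraticAlgebra hd2 h.1 with
      hT | ⟨a, b, A, hA⟩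
    · exact subset_closure hT
    · rcases lt_trichotomy 0 (b ^ 2 + 4 * a) with hab | hab | hab
      · exact subset_closure (RealTensor.isSumOfDecomposables_two_of_disc_pos hd0 hA hab)
      · exact RealTensor.mem_closure_of_disc_eq_zero hd0 hA hab.symm
      · exact subset_closure (RealTensor.isSumOfDecomposables_two_of_disc_neg hd2 hA hab h.2)
  · apply le_antisymm
    · rw [RealTensor.realRank_le_iff hd0]
      rcases RealTensor.isSumOfDecomposables_two_or_quadraticAlgebra hd2 (hflat h) with
        hT | ⟨a, b, A, hA⟩
      · exact hT
      · refine RealTensor.isSumOfDecomposables_two_of_disc_pos hd0 hA ?_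
        obtain ⟨δ, ⟨base, i, j, k, p, q, r, hij, hjk, -, -, -, rfl⟩, hδ⟩ := hdet
        rw [RealTensor.hyperdet_subtensor hA base hij hjk] at hδ
        exact pos_of_mul_pos_right (pos_of_mul_pos_left hδ (sq_nonneg _)) (sq_nonneg a)
    · obtain ⟨_, ⟨I, -, -, rfl⟩, hI⟩ := hrank
      rw [← hI]
      exact RealTensor.rank_flattening_le
        ((RealTensor.realRank_le_iff hd0 T _).mp le_rfl) I
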